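/- Let $k$ be a field of characteristic $0$. Let $\mathcal F$ be the free nonsymmetric $k$-linear operad generated by two binary operations $\bullet$ and $\circ$. Let $\mathcal F(3)_{12}$ be the span of $(x\circ y)\bullet z$ and $x\bullet(y\circ z)$, and let $\mathcal F(3)_{21}$ be the span of $(x\bullet y)\circ z$ and $x\circ(y\bullet z)$. For a linear map $D\colon \mathcal F(3)_{12}\to\mathcal F(3)_{21}$, let $\mathcal P_D$ be the quotient of $\mathcal F$ by the operad ideal generated by the associators $(x\bullet y)\bullet z-x\bullet(y\bullet z)$ and $(x\circ y)\circ z-x\circ(y\circ z)$ and by all elements $u-D(u)$ with $u\in\mathcal F(3)_{12}$. Let $\mathcal P_1$ and $\mathcal P_2$ be the nonsymmetric operads presented by one associative binary operation, $\bullet$ and $\circ$ respectively, with their canonical morphisms to $\mathcal P_D$. Call $D$ a (nonsymmetric) distributive law between two associative multiplications if for every $n\ge 2$ the map $$\xi(n)\colon \bigoplus_{l\ge 1}\ \bigoplus_{m_1+\cdots+m_l=n,\ m_s\ge 1}\mathcal P_2(l)\otimes\mathcal P_1(m_1)\otimes\cdots\otimes\mathcal P_1(m_l)\longrightarrow\mathcal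 P_D(n),\qquad \mu\otimes\nu_1\otimes\cdots\otimes\nu_l\mapsto\mu(\nu_1,\dots,\nu_l),$$ is an isomorphism. Then $D$ is a distributive law if and only if, written as a rewrite rule $u=D(u)$, it is one of (a) $(x\circ y)\bullet z=0$, $\ x\bullet(y\circ z)=0$; (b) $(x\circ y)\bullet z=0$, $\ x\bullet(y\circ z)=(x\bullet y)\circ z$; (c) $(x\circ y)\bullet z=x\circ(y\bullet z)$, $\ x\bullet(y\circ z)=0$; (d) $(x\circ y)\bullet z=x\circ(y\bullet z)$, $\ x\bullet(y\circ z)=(x\bullet y)\circ z$. In particular there are exactly four distributive laws. Moreover, let $a,b,c,d$ be indeterminates and consider the four relations $$\begin{aligned} \alpha_1(x,y,z)&=(x\circ y)\circ z-x\circ(y\circ z),\\ \alpha_2(x,y,z)&=(x\bullet y)\bullet z-x\bullet(y\bullet z),\\ \beta_1(x,y,z)&=(x\circ y)\bullet z+a\,(x\bullet y)\circ z+b\,x\circ(y\bullet z),\\ \beta_2(x,y,z)&=x\bullet(y\circ z)+c\,(x\bullet y)\circ z+d\,x\circ(y\bullet z). \end{aligned}$$ Let $[RR]$ be the $40\times 40$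 matrix over $k[a,b,c,d]$ whose rows are the consequences $\rho(w\star x,y,z)$, $\rho(w,x\star y,z)$, $\rho(w,x,y\star z)$, $\rho(w,x,y)\star z$, $w\star\rho(x,y,z)$, for $\star\in\{\circ,\bullet\}$ and $\rho\in\{\alpha_1,\alpha_2,\beta_1,\beta_2\}$, expanded in the $40$ nonsymmetric monomials of arity $4$ in $\circ,\bullet$. Then, for all values $a,b,c,d\in k$, the map $D$ given by $(x\circ y)\bullet z\mapsto -a\,(x\bullet y)\circ z-b\,x\circ(y\bullet z)$ and $x\bullet(y\circ z)\mapsto -c\,(x\bullet y)\circ z-d\,x\circ(y\bullet z)$ is a distributive law if and only if the matrix $[RR]$ evaluated at $(a,b,c,d)$ has rank $32$. -/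

import Mathlib

noncomputable section

namespace NSOp

universe u v w

/-! ### Planar binary trees and free nonsymmetric operads on binary generators -/

/-- Planar rooted binary trees with inner vertices labelled by `α`, that is, nonsymmetric monomials
in the binary operations `α` (the variables being read off from left to right). -/
inductive BTree (α : Type u) : Type u
  | leaf : BTree α
  | node : α → BTree α → BTree α → BTree α

namespace BTree

/-- Number of leaves (the arity of the monomial). -/
def leaves {α : Type u} : BTree α → ℕ
  | leaf => 1
  | node _ s t => s.leaves + t.leaves

/-- Relabelling of the vertices. -/
def map {α : Type u} {β : Type v} (f : α → β) : BTree α → BTree β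
  | leaf => leaf
  | node a s t => node (f a) (s.map f) (t.map f)

theorem leaves_map {α : Type u} {β : Type v} (f : α → β) (t : BTree α) :
    (t.map f).leaves = t.leaves := by
  induction t with
  | leaf => rfl
  | node a s t hs ht => simp [map, leaves, hs, ht]

end BTree

/-- Trees with exactly `n` leaves. -/
abbrev TreeN (α : Type u) (n : ℕ) : Type u := {t : BTree α // t.leaves = n}

/-- The linear span of all trees: the direct sum of all components of the free nonsymmetric operad
generated by the vector space with basis `α` placed in arity `2`. -/
abbrev Total (R : Type w) [CommRing R] (α : Type u) : Type (max u w) := BTree α →₀ R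

/-- The arity `n` component of the free nonsymmetric operad generated by the vector space
with basis `α` placed in arity `2`. -/
abbrev Free (R : Type w) [CommRing R] (α : Type u) (n : ℕ) : Type (max u w) := TreeN α n →₀ R

section FreeOperad

variable (R : Type w) [CommRing R] {α : Type u} {β : Type v}

/-- Inclusion of the arity `n` component in the sum of all components. -/
def incl (n : ℕ) : Free R α n →ₗ[R] Total R α := Finsupp.lmapDomain R R Subtype.val

/-- Projection of the sum of all components to the arity `n` component. -/
def proj (n : ℕ) : Total R α →ₗ[R] Free R α n := Finsupp.lsubtypeDomain {t : BTree α | t.leaves = n}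

/-- The bilinear operation `(s, t) ↦ s a t` belonging to the generator `a`. -/
def mul (a : α) : Total R α →ₗ[R] Total R α →ₗ[R] Total R α :=
  Finsupp.linearCombination R fun s : BTree α =>
    Finsupp.linearCombination R fun t : BTree α => Finsupp.single (BTree.node a s t) (1 : R)

/-- Substitution into the monomial `t`: the `i`-th leaf is replaced by `x i`. -/
def substFun : (t : BTree α) → (Fin t.leaves → Total R α) → Total R α
  | .leaf, x => x (0 : Fin 1)
  | .node a s t, x =>
      mul R a (substFun s fun i => x (Fin.castAdd t.leaves i))
        (substFun t fun i => x (Fin.natAdd s.leaves i))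

variable {R}

theorem update_castAdd {M : Type*} {m n : ℕ} (x : Fin (m + n) → M) (i : Fin m) (y : M) :
    (fun j => Function.update x (Fin.castAdd n i) y (Fin.castAdd n j)) =
        Function.update (fun j => x (Fin.castAdd n j)) i y ∧
      (fun j => Function.update x (Fin.castAdd n i) y (Fin.natAdd m j)) =
        fun j => x (Fin.natAdd m j) := by
  constructor <;> funext j
  · by_cases h : j = i
    · subst h; simp
    · rw [Function.update_of_ne h, Function.update_of_ne]
      simpa [Fin.ext_iff] using h
  · rw [Function.update_of_ne]
    simp only [ne_eq, Fin.ext_iff, Fin.val_natAdd, Fin.val_castAdd]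
    omega

theorem update_natAdd {M : Type*} {m n : ℕ} (x : Fin (m + n) → M) (i : Fin n) (y : M) :
    (fun j => Function.update x (Fin.natAdd m i) y (Fin.natAdd m j)) =
        Function.update (fun j => x (Fin.natAdd m j)) i y ∧
      (fun j => Function.update x (Fin.natAdd m i) y (Fin.castAdd n j)) =
        fun j => x (Fin.castAdd n j) := by
  constructor <;> funext j
  · by_cases h : j = i
    · subst h; simp
    · rw [Function.update_of_ne h, Function.update_of_ne]
      simpa [Fin.ext_iff] using h
  · rw [Function.update_of_ne]
    simp only [ne_eq, Fin.ext_iff, Fin.val_natAdd, Fin.val_castAdd]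
    omega

theorem substFun_add (t : BTree α) (x : Fin t.leaves → Total R α) (i : Fin t.leaves)
    (y z : Total R α) :
    substFun R t (Function.update x i (y + z)) =
      substFun R t (Function.update x i y) + substFun R t (Function.update x i z) := by
  induction t with
  | leaf =>
    change Fin 1 at i
    obtain rfl : i = 0 := Subsingleton.elim _ _
    simp only [substFun]
    erw [Function.update_self, Function.update_self, Function.update_self]
  | node a s t hs ht =>
    simp only [substFun]
    change Fin (s.leaves + t.leaves) at i
    change Fin (s.leaves + t.leaves) → _ at x
    induction i using Fin.addCases with
    | left i =>
      erw [(update_castAdd x i (y + z)).1, (update_castAdd x i (y + z)).2,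
        (update_castAdd x i y).1, (update_castAdd x i y).2,
        (update_castAdd x i z).1, (update_castAdd x i z).2, hs]
      simp
    | right i =>
      erw [(update_natAdd x i (y + z)).1, (update_natAdd x i (y + z)).2,
        (update_natAdd x i y).1, (update_natAdd x i y).2,
        (update_natAdd x i z).1, (update_natAdd x i z).2, ht]
      simp

theorem substFun_smul (t : BTree α) (x : Fin t.leaves → Total R α) (i : Fin t.leaves)
    (c : R) (y : Total R α) :
    substFun R t (Function.update x i (c • y)) = c • substFun R t (Function.update x i y) := by
  induction t with
  | leaf =>
    change Fin 1 at i
    obtain rfl : i = 0 := Subsingleton.elim _ _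
    simp only [substFun]
    erw [Function.update_self, Function.update_self]
  | node a s t hs ht =>
    simp only [substFun]
    change Fin (s.leaves + t.leaves) at i
    change Fin (s.leaves + t.leaves) → _ at x
    induction i using Fin.addCases with
    | left i =>
      erw [(update_castAdd x i (c • y)).1, (update_castAdd x i (c • y)).2,
        (update_castAdd x i y).1, (update_castAdd x i y).2, hs]
      simp
    | right i =>
      erw [(update_natAdd x i (c • y)).1, (update_natAdd x i (c • y)).2,
        (update_natAdd x i y).1, (update_natAdd x i y).2, ht]
      simp

variable (R)

/-- Substitution into the monomial `t`, as a multilinear map. -/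
def subst (t : BTree α) : MultilinearMap R (fun _ : Fin t.leaves => Total R α) (Total R α) where
  toFun := substFun R t
  map_update_add' {inst} x i y z := by
    obtain rfl : inst = instDecidableEqFin _ := Subsingleton.elim _ _
    exact substFun_add t x i y z
  map_update_smul' {inst} x i c y := by
    obtain rfl : inst = instDecidableEqFin _ := Subsingleton.elim _ _
    exact substFun_smul t x i c y

/-- The structure operation
`(μ, (ν₁, …, ν_l)) ↦ μ(ν₁, …, ν_l)`, `Free l × Free m₁ × ⋯ × Free m_l → Free n`, of the free
nonsymmetric operad, where `n = m₁ + ⋯ + m_l` (for all other `n` the map below is zero). -/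
def comp {l : ℕ} (m : Fin l → ℕ) (n : ℕ) :
    Free R α l →ₗ[R] MultilinearMap R (fun i => Free R α (m i)) (Free R α n) :=
  Finsupp.linearCombination R fun t : TreeN α l =>
    (proj R n).compMultilinearMap
      (((subst R t.1).domDomCongr (finCongr t.2)).compLinearMap fun i => incl R (m i))

/-- The morphism of free operads induced by a map between the bases of generators. -/
def freeMap (f : α → β) (n : ℕ) : Free R α n →ₗ[R] Free R β n :=
  Finsupp.lmapDomain R R fun t : TreeN α n => ⟨t.1.map f, (BTree.leaves_map f t.1).trans t.2⟩

/-- The corresponding map between the sums of all components. -/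
def totalMap (f : α → β) : Total R α →ₗ[R] Total R β := Finsupp.lmapDomain R R (BTree.map f)

variable {R}

theorem totalMap_mul (f : α → β) (a : α) (x y : Total R α) :
    totalMap R f (mul R a x y) = mul R (f a) (totalMap R f x) (totalMap R f y) := by
  have h : ((mul R a).compr₂ (totalMap R f)) =
      (mul R (f a)).compl₁₂ (totalMap R f) (totalMap R f) := by
    ext s t : 4
    simp [mul, totalMap, BTree.map]
  exact LinearMap.congr_fun₂ h x y

theorem totalMap_substFun (f : α → β) (t : BTree α) (x : Fin t.leaves → Total R α) :
    totalMap R f (substFun R t x) =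
      substFun R (t.map f) fun i => totalMap R f (x (finCongr (BTree.leaves_map f t) i)) := by
  induction t with
  | leaf => rfl
  | node a s t hs ht =>
    simp only [substFun, BTree.map]
    rw [totalMap_mul, hs, ht]
    congr 2
    funext i
    congr 2
    ext
    change s.leaves + (i : ℕ) = (s.map f).leaves + (i : ℕ)
    exact congrArg (· + (i : ℕ)) (BTree.leaves_map f s).symm

theorem incl_freeMap (f : α → β) (n : ℕ) (x : Free R α n) :
    incl R n (freeMap R f n x) = totalMap R f (incl R n x) := by
  simp only [incl, freeMap, totalMap, Finsupp.lmapDomain_apply, ← Finsupp.mapDomain_comp]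
  rfl

theorem proj_single (t : BTree α) (n : ℕ) (c : R) :
    proj R n (Finsupp.single t c) =
      if h : t.leaves = n then Finsupp.single (⟨t, h⟩ : TreeN α n) c else 0 := by
  classical
  ext s
  change Finsupp.single t c s.1 = _
  split_ifs with h
  · simp [Finsupp.single_apply, Subtype.ext_iff]
  · have hs : t ≠ s.1 := by
      rintro rfl
      exact h s.2
    simp [hs]

theorem proj_totalMap (f : α → β) (n : ℕ) (x : Total R α) :
    proj R n (totalMap R f x) = freeMap R f n (proj R n x) := by
  have h : (proj R n) ∘ₗ (totalMap R f) = (freeMap R f n) ∘ₗ (proj R n) := by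
    ext t : 2
    by_cases ht : t.leaves = n <;>
      simp [totalMap, freeMap, proj_single, BTree.leaves_map, ht]
  exact LinearMap.congr_fun h x

theorem freeMap_comp (f : α → β) {l : ℕ} (m : Fin l → ℕ) (n : ℕ) (μ : Free R α l)
    (ν : ∀ i, Free R α (m i)) :
    freeMap R f n (comp R m n μ ν) =
      comp R m n (freeMap R f l μ) fun i => freeMap R f (m i) (ν i) := by
  induction μ using Finsupp.induction_linear with
  | zero => simp
  | add x y hx hy => simp only [map_add, add_apply, hx, hy]
  | single t c =>
    obtain ⟨t, rfl⟩ := t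
    simp only [comp, freeMap, Finsupp.lmapDomain_apply, Finsupp.mapDomain_single,
      Finsupp.linearCombination_single, smul_apply, map_smul]
    congr 1
    change freeMap R f n (proj R n (substFun R t fun i => incl R (m i) (ν i))) =
      proj R n (substFun R (t.map f) fun i =>
        incl R (m (finCongr (BTree.leaves_map f t) i))
          (freeMap R f _ (ν (finCongr (BTree.leaves_map f t) i))))
    rw [← proj_totalMap, totalMap_substFun]
    simp only [incl_freeMap]

end FreeOperad

/-! ### Operad ideals and operads given by generators and quadratic relations -/

section Quotient

variable {R : Type w} [CommRing R] {α : Type u} {β : Type v}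

/-- A collection of subspaces is an operad ideal if `μ(ν₁, …, ν_l)` lies in it whenever one of
`μ, ν₁, …, ν_l` does. -/
structure IsIdeal (I : ∀ n, Submodule R (Free R α n)) : Prop where
  outer : ∀ {l : ℕ} (m : Fin l → ℕ) (n : ℕ) (μ : Free R α l) (ν : ∀ i, Free R α (m i)),
    μ ∈ I l → comp R m n μ ν ∈ I n
  inner : ∀ {l : ℕ} (m : Fin l → ℕ) (n : ℕ) (μ : Free R α l) (ν : ∀ i, Free R α (m i)) (i : Fin l),
    ν i ∈ I (m i) → comp R m n μ ν ∈ I n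

/-- The operad ideal generated by quadratic relations `S ⊆ Free 3`. -/
def ideal (S : Submodule R (Free R α 3)) (n : ℕ) : Submodule R (Free R α n) :=
  ⨅ (I : ∀ n, Submodule R (Free R α n)) (_ : IsIdeal I) (_ : S ≤ I 3), I n

theorem mem_ideal {S : Submodule R (Free R α 3)} {n : ℕ} {x : Free R α n} :
    x ∈ ideal S n ↔ ∀ I : ∀ n, Submodule R (Free R α n), IsIdeal I → S ≤ I 3 → x ∈ I n := by
  simp [ideal, Submodule.mem_iInf]

theorem isIdeal_ideal (S : Submodule R (Free R α 3)) : IsIdeal (ideal S) where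
  outer m n μ ν h := mem_ideal.2 fun I hI hS => hI.outer m n μ ν (mem_ideal.1 h I hI hS)
  inner m n μ ν i h := mem_ideal.2 fun I hI hS => hI.inner m n μ ν i (mem_ideal.1 h I hI hS)

theorem le_ideal (S : Submodule R (Free R α 3)) : S ≤ ideal S 3 :=
  fun _ hx => mem_ideal.2 fun _ _ hS => hS hx

/-- The arity `n` component of the operad with generators `α` and relations `S`. -/
abbrev Operad (S : Submodule R (Free R α 3)) (n : ℕ) : Type (max u w) := Free R α n ⧸ ideal S n

/-- A multilinear map vanishing as soon as one argument is in the submodule `K i`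
depends only on the classes of its arguments. -/
theorem multilinear_congr {l : ℕ} {M : Fin l → Type*} [∀ i, AddCommGroup (M i)]
    [∀ i, Module R (M i)] {N : Type*} [AddCommGroup N] [Module R N] (K : ∀ i, Submodule R (M i))
    (g : MultilinearMap R M N) (hg : ∀ x i, x i ∈ K i → g x = 0) (x y : ∀ i, M i)
    (h : ∀ i, x i - y i ∈ K i) : g x = g y := by
  suffices H : ∀ s : Finset (Fin l), g (s.piecewise x y) = g y by
    simpa using H Finset.univ
  intro s
  induction s using Finset.induction_on with
  | empty => simp
  | insert i s hi ih =>
    rw [← ih, Finset.piecewise_insert, ← sub_eq_zero]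
    have h2 : s.piecewise x y = Function.update (s.piecewise x y) i (y i) := by
      simp [hi]
    conv_lhs => rw [h2, Function.update_idem, ← MultilinearMap.map_update_sub]
    refine hg _ i ?_
    simpa using h i

/-- Descent of a multilinear map to quotients. -/
def multilinearDescend {l : ℕ} {M : Fin l → Type*} [∀ i, AddCommGroup (M i)]
    [∀ i, Module R (M i)] {N : Type*} [AddCommGroup N] [Module R N] (K : ∀ i, Submodule R (M i))
    (g : MultilinearMap R M N) (hg : ∀ x i, x i ∈ K i → g x = 0) :
    MultilinearMap R (fun i => M i ⧸ K i) N where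
  toFun y := g fun i => (y i).out
  map_update_add' {inst} y i a b := by
    obtain rfl : inst = instDecidableEqFin _ := Subsingleton.elim _ _
    have key : ∀ c : M i ⧸ K i, ∀ c' : M i, Submodule.Quotient.mk c' = c →
        g (fun j => (Function.update y i c j).out) =
          g (Function.update (fun j => (y j).out) i c') := by
      rintro _ c' rfl
      refine multilinear_congr K g hg _ _ fun j => ?_
      rw [← Submodule.Quotient.eq]
      by_cases hj : j = i
      · subst hj; simp [Submodule.Quotient.mk_out]
      · simp [hj]
    rw [key (a + b) (a.out + b.out) (by simp [Submodule.Quotient.mk_out]),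
      key a a.out (Submodule.Quotient.mk_out _), key b b.out (Submodule.Quotient.mk_out _),
      g.map_update_add]
  map_update_smul' {inst} y i r a := by
    obtain rfl : inst = instDecidableEqFin _ := Subsingleton.elim _ _
    have key : ∀ c : M i ⧸ K i, ∀ c' : M i, Submodule.Quotient.mk c' = c →
        g (fun j => (Function.update y i c j).out) =
          g (Function.update (fun j => (y j).out) i c') := by
      rintro _ c' rfl
      refine multilinear_congr K g hg _ _ fun j => ?_
      rw [← Submodule.Quotient.eq]
      by_cases hj : j = i
      · subst hj; simp [Submodule.Quotient.mk_out]
      · simp [hj]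
    rw [key (r • a) (r • a.out) (by simp [Submodule.Quotient.mk_out]),
      key a a.out (Submodule.Quotient.mk_out _), g.map_update_smul]

theorem multilinearDescend_mk {l : ℕ} {M : Fin l → Type*} [∀ i, AddCommGroup (M i)]
    [∀ i, Module R (M i)] {N : Type*} [AddCommGroup N] [Module R N] (K : ∀ i, Submodule R (M i))
    (g : MultilinearMap R M N) (hg : ∀ x i, x i ∈ K i → g x = 0) (x : ∀ i, M i) :
    multilinearDescend K g hg (fun i => Submodule.Quotient.mk (x i)) = g x := by
  refine multilinear_congr K g hg _ _ fun j => ?_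
  rw [← Submodule.Quotient.eq]
  exact Submodule.Quotient.mk_out _

/-- The composition of the quotient operad, with the outer operation still in the free operad. -/
def compAux (S : Submodule R (Free R α 3)) {l : ℕ} (m : Fin l → ℕ) (n : ℕ) :
    Free R α l →ₗ[R] MultilinearMap R (fun i => Operad S (m i)) (Operad S n) where
  toFun μ := multilinearDescend (fun i => ideal S (m i))
    ((ideal S n).mkQ.compMultilinearMap (comp R m n μ)) fun ν i h => by
      simpa using (isIdeal_ideal S).inner m n μ ν i h
  map_add' μ μ' := by
    ext y
    simp [multilinearDescend]
  map_smul' c μ := by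
    ext y
    simp [multilinearDescend]

/-- The structure operation `(μ, (ν₁, …, ν_l)) ↦ μ(ν₁, …, ν_l)` of the operad with generators `α`
and relations `S`, for `n = m₁ + ⋯ + m_l`. -/
def compQ (S : Submodule R (Free R α 3)) {l : ℕ} (m : Fin l → ℕ) (n : ℕ) :
    Operad S l →ₗ[R] MultilinearMap R (fun i => Operad S (m i)) (Operad S n) :=
  (ideal S l).liftQ (compAux S m n) fun μ hμ => by
    rw [LinearMap.mem_ker]
    ext y
    simpa [compAux, multilinearDescend] using
      (isIdeal_ideal S).outer m n μ (fun i => (y i).out) hμ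

theorem compQ_mk (S : Submodule R (Free R α 3)) {l : ℕ} (m : Fin l → ℕ) (n : ℕ)
    (μ : Free R α l) (ν : ∀ i, Free R α (m i)) :
    compQ S m n (Submodule.Quotient.mk μ) (fun i => Submodule.Quotient.mk (ν i)) =
      Submodule.Quotient.mk (comp R m n μ ν) :=
  multilinearDescend_mk (fun i => ideal S (m i))
    ((ideal S n).mkQ.compMultilinearMap (comp R m n μ))
    (fun ν i h => by simpa using (isIdeal_ideal S).inner m n μ ν i h) ν

theorem ideal_le_comap (f : α → β) (S : Submodule R (Free R α 3)) (S' : Submodule R (Free R β 3))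
    (h : S.map (freeMap R f 3) ≤ S') (n : ℕ) :
    ideal S n ≤ (ideal S' n).comap (freeMap R f n) := by
  intro x hx
  refine mem_ideal.1 hx (fun n => (ideal S' n).comap (freeMap R f n)) ⟨?_, ?_⟩ ?_
  · intro l m n μ ν hμ
    rw [Submodule.mem_comap, freeMap_comp]
    exact (isIdeal_ideal S').outer _ _ _ _ hμ
  · intro l m n μ ν i hν
    rw [Submodule.mem_comap, freeMap_comp]
    exact (isIdeal_ideal S').inner _ _ _ _ i hν
  · exact (Submodule.map_le_iff_le_comap.1 h).trans (Submodule.comap_mono (le_ideal S'))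

/-- The morphism of operads induced by a map of generators that preserves relations. -/
def operadMap (f : α → β) (S : Submodule R (Free R α 3)) (S' : Submodule R (Free R β 3))
    (h : S.map (freeMap R f 3) ≤ S') (n : ℕ) : Operad S n →ₗ[R] Operad S' n :=
  (ideal S n).mapQ (ideal S' n) (freeMap R f n) (ideal_le_comap f S S' h n)

end Quotient

/-! ### Rewrite rules and distributive laws -/

section Distributive

variable (R : Type w) [CommRing R] {α : Type u} {β : Type v}

/-- The monomial `(x q y) p z`. -/
def leftTree (p q : α) : TreeN α 3 := ⟨.node p (.node q .leaf .leaf) .leaf, rfl⟩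

/-- The monomial `x p (y q z)`. -/
def rightTree (p q : α) : TreeN α 3 := ⟨.node p .leaf (.node q .leaf .leaf), rfl⟩

/-- `(x q y) p z` as an element of the free operad. -/
def leftMon (p q : α) : Free R α 3 := Finsupp.single (leftTree p q) 1

/-- `x p (y q z)` as an element of the free operad. -/
def rightMon (p q : α) : Free R α 3 := Finsupp.single (rightTree p q) 1

/-- The span of all `p(q, 1)` and `p(1, q)` with `p ∈ A` and `q ∈ B`. -/
def mixed (A B : Set α) : Submodule R (Free R α 3) :=
  Submodule.span R {x | ∃ p ∈ A, ∃ q ∈ B, x = leftMon R p q ∨ x = rightMon R p q}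

/-- The subspace `F(E₁ ⊕ E₂)(3)₁₂`, where `E₁` has basis `α` and `E₂` has basis `β`:
outer operation from `E₁`, inner operation from `E₂`. -/
abbrev F12 (α : Type u) (β : Type v) : Submodule R (Free R (α ⊕ β) 3) :=
  mixed R (Set.range Sum.inl) (Set.range Sum.inr)

/-- The subspace `F(E₁ ⊕ E₂)(3)₂₁`: outer operation from `E₂`, inner operation from `E₁`. -/
abbrev F21 (α : Type u) (β : Type v) : Submodule R (Free R (α ⊕ β) 3) :=
  mixed R (Set.range Sum.inr) (Set.range Sum.inl)

variable {R}

/-- The relations `x - D x`, `x ∈ F(E)(3)₁₂`. -/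
def ruleRel (D : F12 R α β →ₗ[R] F21 R α β) : Submodule R (Free R (α ⊕ β) 3) :=
  Submodule.span R (Set.range fun x : F12 R α β => (x : Free R (α ⊕ β) 3) - D x)

/-- The relations `R₁ ⊕ R_D ⊕ R₂` of the combined operad. -/
def combinedRel (R₁ : Submodule R (Free R α 3)) (R₂ : Submodule R (Free R β 3))
    (D : F12 R α β →ₗ[R] F21 R α β) : Submodule R (Free R (α ⊕ β) 3) :=
  R₁.map (freeMap R Sum.inl 3) ⊔ ruleRel D ⊔ R₂.map (freeMap R Sum.inr 3)

/-- The canonical morphism from `P₁ = ⟨E₁; R₁⟩` to the combined operad. -/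
def fromFirst (R₁ : Submodule R (Free R α 3)) (R₂ : Submodule R (Free R β 3))
    (D : F12 R α β →ₗ[R] F21 R α β) (n : ℕ) : Operad R₁ n →ₗ[R] Operad (combinedRel R₁ R₂ D) n :=
  operadMap Sum.inl R₁ _ (le_sup_left.trans le_sup_left) n

/-- The canonical morphism from `P₂ = ⟨E₂; R₂⟩` to the combined operad. -/
def fromSecond (R₁ : Submodule R (Free R α 3)) (R₂ : Submodule R (Free R β 3))
    (D : F12 R α β →ₗ[R] F21 R α β) (n : ℕ) : Operad R₂ n →ₗ[R] Operad (combinedRel R₁ R₂ D) n :=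
  operadMap Sum.inr R₂ _ le_sup_right n

open scoped TensorProduct DirectSum

/-- `(P₂ ∘ P₁)(n)`: the direct sum, over all `m₁ + ⋯ + m_l = n` with `m_s ≥ 1`, of
`P₂(l) ⊗ P₁(m₁) ⊗ ⋯ ⊗ P₁(m_l)`. -/
abbrev Composite (R₁ : Submodule R (Free R α 3)) (R₂ : Submodule R (Free R β 3)) (n : ℕ) :
    Type (max u v w) :=
  ⨁ c : Composition n,
    Operad R₂ c.length ⊗[R] (⨂[R] i : Fin c.length, Operad R₁ (c.blocksFun i))

/-- The map `ξ(n) : (P₂ ∘ P₁)(n) → P(n)` to the combined operad `P`, sending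
`μ ⊗ ν₁ ⊗ ⋯ ⊗ ν_l` to `μ(ν₁, …, ν_l)`. -/
def xi (R₁ : Submodule R (Free R α 3)) (R₂ : Submodule R (Free R β 3))
    (D : F12 R α β →ₗ[R] F21 R α β) (n : ℕ) :
    Composite R₁ R₂ n →ₗ[R] Operad (combinedRel R₁ R₂ D) n :=
  DirectSum.toModule R (Composition n) _ fun c =>
    TensorProduct.lift
      ((PiTensorProduct.lift (R := R)).toLinearMap ∘ₗ
        MultilinearMap.compLinearMapₗ (fun i => fromFirst R₁ R₂ D (c.blocksFun i)) ∘ₗ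
        compQ (combinedRel R₁ R₂ D) c.blocksFun n ∘ₗ
        fromSecond R₁ R₂ D c.length)

/-- `D` is a distributive law of `P₁ = ⟨E₁; R₁⟩` over `P₂ = ⟨E₂; R₂⟩`. -/
def IsDistributiveLaw (R₁ : Submodule R (Free R α 3)) (R₂ : Submodule R (Free R β 3))
    (D : F12 R α β →ₗ[R] F21 R α β) : Prop :=
  ∀ n : ℕ, 2 ≤ n → Function.Bijective (xi R₁ R₂ D n)

end Distributive

/-! ### Two associative multiplications -/

/-- The associativity relation `(xy)z - x(yz)` for one binary operation. -/
def assRel (R : Type w) [CommRing R] : Submodule R (Free R Unit 3) :=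
  Submodule.span R {leftMon R () () - rightMon R () ()}

/-- The two multiplications. -/
abbrev Op : Type := Unit ⊕ Unit

/-- The multiplication `•`, generating `E₁`. -/
abbrev bul : Op := Sum.inl ()

/-- The multiplication `∘`, generating `E₂`. -/
abbrev cir : Op := Sum.inr ()

/-- Rewrite rules, with left hand sides `(x ∘ y) • z` and `x • (y ∘ z)`. -/
abbrev Rule (R : Type w) [CommRing R] : Type w := F12 R Unit Unit →ₗ[R] F21 R Unit Unit

/-- `(x ∘ y) • z` -/
def lhs₁ (R : Type w) [CommRing R] : F12 R Unit Unit :=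
  ⟨leftMon R bul cir, Submodule.subset_span ⟨bul, ⟨(), rfl⟩, cir, ⟨(), rfl⟩, Or.inl rfl⟩⟩

/-- `x • (y ∘ z)` -/
def lhs₂ (R : Type w) [CommRing R] : F12 R Unit Unit :=
  ⟨rightMon R bul cir, Submodule.subset_span ⟨bul, ⟨(), rfl⟩, cir, ⟨(), rfl⟩, Or.inr rfl⟩⟩

/-- `(x • y) ∘ z` -/
def rhs₁ (R : Type w) [CommRing R] : F21 R Unit Unit :=
  ⟨leftMon R cir bul, Submodule.subset_span ⟨cir, ⟨(), rfl⟩, bul, ⟨(), rfl⟩, Or.inl rfl⟩⟩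

/-- `x ∘ (y • z)` -/
def rhs₂ (R : Type w) [CommRing R] : F21 R Unit Unit :=
  ⟨rightMon R cir bul, Submodule.subset_span ⟨cir, ⟨(), rfl⟩, bul, ⟨(), rfl⟩, Or.inr rfl⟩⟩

/-- `D` is a distributive law between two associative multiplications. -/
def IsAssAssLaw {R : Type w} [CommRing R] (D : Rule R) : Prop :=
  IsDistributiveLaw (assRel R) (assRel R) D

/-! ### The matrix of cubic consequences -/

section CubicMatrix

variable (A : Type w) [CommRing A]

/-- The four quadratic relations as functions of three arguments: associativity of `∘` and of `•`,
`(x ∘ y) • z + a (x • y) ∘ z + b x ∘ (y • z)` and `x • (y ∘ z) + c (x • y) ∘ z + d x ∘ (y • z)`. -/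
def quadRel (a b c d : A) : Fin 4 → Total A Op → Total A Op → Total A Op → Total A Op :=
  ![fun x y z => mul A cir (mul A cir x y) z - mul A cir x (mul A cir y z),
    fun x y z => mul A bul (mul A bul x y) z - mul A bul x (mul A bul y z),
    fun x y z => mul A bul (mul A cir x y) z + a • mul A cir (mul A bul x y) z
      + b • mul A cir x (mul A bul y z),
    fun x y z => mul A bul x (mul A cir y z) + c • mul A cir (mul A bul x y) z
      + d • mul A cir x (mul A bul y z)]

/-- The ten consequences of arity `4` of a quadratic relation `ρ`. All the variables `w, x, y, z`
are written as the one-leaf tree `e`, their order being the order of the leaves. -/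
def cubicConsequence (ρ : Total A Op → Total A Op → Total A Op → Total A Op) :
    Fin 10 → Total A Op :=
  let e : Total A Op := Finsupp.single BTree.leaf 1
  ![ρ (mul A cir e e) e e, ρ (mul A bul e e) e e, ρ e (mul A cir e e) e, ρ e (mul A bul e e) e,
    ρ e e (mul A cir e e), ρ e e (mul A bul e e), mul A cir (ρ e e e) e, mul A bul (ρ e e e) e,
    mul A cir e (ρ e e e), mul A bul e (ρ e e e)]

/-- The monomials of arity `4`: five association types with operations `p, q, r`. -/
def cubicMonomial (p q r : Op) : Fin 5 → BTree Op :=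
  let e : BTree Op := BTree.leaf
  ![.node r (.node q (.node p e e) e) e, .node r (.node p e (.node q e e)) e,
    .node q (.node p e e) (.node r e e), .node p e (.node r (.node q e e) e),
    .node p e (.node q e (.node r e e))]

end CubicMatrix

/-- The `40 × 40` matrix `[RR]` over `k[a, b, c, d]`: the rows are the ten cubic consequences of
each of the four quadratic relations, expanded in the monomials of arity `4`. -/
def cubicMatrix (k : Type w) [CommRing k] :
    Matrix (Fin 4 × Fin 10) (Fin 5 × Op × Op × Op) (MvPolynomial (Fin 4) k) :=
  fun i j =>
    cubicConsequence _
      (quadRel _ (MvPolynomial.X 0) (MvPolynomial.X 1) (MvPolynomial.X 2) (MvPolynomial.X 3) i.1)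
      i.2 (cubicMonomial j.2.1 j.2.2.1 j.2.2.2 j.1)

end NSOp

end

/-!
The map `ξ(n)` is always surjective, since the rewrite rules move `∘` outwards past `•`, so that
every monomial is a combination of normal ones: products under `∘` of products under `•`. Hence only
injectivity is at stake.

In arity `4` the row space of `[RR]` is the degree `4` part of the operad ideal. As there are `40`
monomials and `8` compositions of `4`, the rank is `32` exactly when `ξ(4)` is bijective.

If `ξ(4)` is injective, then resolving each of the ambiguities `((w ∘ x) ∘ y) • z`,
`w • (x ∘ (y ∘ z))`, `((w ∘ x) • y) • z` and `w • (x • (y ∘ z))` in two ways and comparing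
coefficients of normal monomials gives `a = d = 0` and `b, c ∈ {0, -1}`, as soon as `2 ≠ 0`.
Conversely, each of the four remaining laws is realised on words in the letters `•` and `∘`, where
products which the law sends to zero are discarded; there distinct normal monomials become distinct
words.
-/

noncomputable section

namespace NSOp

universe u v w

open scoped TensorProduct DirectSum

section Homogeneous

variable {R : Type w} [CommRing R] {α : Type u}

theorem incl_single {n : ℕ} (t : TreeN α n) (c : R) :
    incl R n (Finsupp.single t c) = Finsupp.single t.1 c := by
  simp [incl]

theorem proj_incl (n : ℕ) (x : Free R α n) : proj R n (incl R n x) = x := by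
  induction x using Finsupp.induction_linear with
  | zero => simp
  | add x y hx hy => simp [hx, hy]
  | single t c => simp [incl_single, proj_single, t.2]

theorem proj_incl_of_ne {m n : ℕ} (h : m ≠ n) (x : Free R α m) : proj R n (incl R m x) = 0 := by
  induction x using Finsupp.induction_linear with
  | zero => simp
  | add x y hx hy => simp [hx, hy]
  | single t c => simp [incl_single, proj_single, t.2, h]

theorem mul_single_single (a : α) (s t : BTree α) (b c : R) :
    mul R a (Finsupp.single s b) (Finsupp.single t c) =
      Finsupp.single (BTree.node a s t) (b * c) := by
  simp [mul]

theorem BTree.leaves_pos (t : BTree α) : 0 < t.leaves := by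
  induction t with
  | leaf => exact Nat.one_pos
  | node _ _ _ hs _ => exact Nat.add_pos_left hs _

/-- The homogeneous elements of degree `n` in the sum of all components. -/
def homog (R : Type w) [CommRing R] (α : Type u) (n : ℕ) : Submodule R (Total R α) :=
  LinearMap.range (incl R n)

theorem incl_mem_homog {n : ℕ} (x : Free R α n) : incl R n x ∈ homog R α n := ⟨x, rfl⟩

theorem single_mem_homog (t : BTree α) (c : R) : Finsupp.single t c ∈ homog R α t.leaves :=
  ⟨Finsupp.single ⟨t, rfl⟩ c, incl_single _ _⟩

theorem incl_proj {n : ℕ} {x : Total R α} (hx : x ∈ homog R α n) : incl R n (proj R n x) = x := by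
  obtain ⟨x, rfl⟩ := hx
  rw [proj_incl]

theorem proj_of_ne {m n : ℕ} (h : m ≠ n) {x : Total R α} (hx : x ∈ homog R α m) :
    proj R n x = 0 := by
  obtain ⟨x, rfl⟩ := hx
  exact proj_incl_of_ne h x

theorem mul_mem_homog (a : α) {p q : ℕ} {x y : Total R α} (hx : x ∈ homog R α p)
    (hy : y ∈ homog R α q) : mul R a x y ∈ homog R α (p + q) := by
  obtain ⟨x, rfl⟩ := hx
  obtain ⟨y, rfl⟩ := hy
  induction x using Finsupp.induction_linear with
  | zero => simp
  | add x x' hx hx' => simpa using add_mem hx hx'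
  | single s b =>
    induction y using Finsupp.induction_linear with
    | zero => simp
    | add y y' hy hy' => simpa using add_mem hy hy'
    | single t c =>
      obtain ⟨s, rfl⟩ := s
      obtain ⟨t, rfl⟩ := t
      simpa only [incl_single, mul_single_single, BTree.leaves] using
        single_mem_homog (BTree.node a s t) (b * c)

theorem substFun_mem_homog (t : BTree α) (m : Fin t.leaves → ℕ) (x : Fin t.leaves → Total R α)
    (hx : ∀ i, x i ∈ homog R α (m i)) : substFun R t x ∈ homog R α (∑ i, m i) := by
  induction t with
  | leaf =>
    have : ∑ i, m i = m (0 : Fin 1) := Fin.sum_univ_one (m : Fin 1 → ℕ)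
    rw [this]
    exact hx (0 : Fin 1)
  | node a s t hs ht =>
    have : ∑ i, m i = ∑ i, m (Fin.castAdd t.leaves i) + ∑ i, m (Fin.natAdd s.leaves i) :=
      Fin.sum_univ_add (m : Fin (s.leaves + t.leaves) → ℕ)
    rw [this]
    exact mul_mem_homog a (hs _ _ fun i => hx _) (ht _ _ fun i => hx _)

end Homogeneous

section Substitution

variable {R : Type w} [CommRing R] {α : Type u}

/-- Substitution into an element of the free operad, as a multilinear map: this is the composition
of the free operad without the bookkeeping of arities. -/
def substFree (l : ℕ) :
    Free R α l →ₗ[R] MultilinearMap R (fun _ : Fin l => Total R α) (Total R α) :=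
  Finsupp.linearCombination R fun t : TreeN α l => (subst R t.1).domDomCongr (finCongr t.2)

theorem substFree_single {l : ℕ} (t : TreeN α l) (c : R) (x : Fin l → Total R α) :
    substFree l (Finsupp.single t c) x = c • substFun R t.1 fun i => x (finCongr t.2 i) := by
  rw [substFree, Finsupp.linearCombination_single]
  rfl

theorem substFree_leftMon (p q : α) (x y z : Total R α) :
    substFree 3 (leftMon R p q) ![x, y, z] = mul R p (mul R q x y) z := by
  rw [leftMon, substFree_single, one_smul]
  rfl

theorem substFree_rightMon (p q : α) (x y z : Total R α) :
    substFree 3 (rightMon R p q) ![x, y, z] = mul R p x (mul R q y z) := by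
  rw [rightMon, substFree_single, one_smul]
  rfl

theorem substFree_mem_homog {l : ℕ} (m : Fin l → ℕ) (μ : Free R α l) {x : Fin l → Total R α}
    (hx : ∀ i, x i ∈ homog R α (m i)) : substFree l μ x ∈ homog R α (∑ i, m i) := by
  induction μ using Finsupp.induction_linear with
  | zero => simp
  | add μ μ' hμ hμ' => simpa using add_mem hμ hμ'
  | single t c =>
    obtain ⟨t, rfl⟩ := t
    rw [substFree_single]
    exact Submodule.smul_mem _ c (substFun_mem_homog t m _ hx)

theorem comp_eq_proj {l : ℕ} (m : Fin l → ℕ) (n : ℕ) (μ : Free R α l)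
    (ν : ∀ i, Free R α (m i)) :
    comp R m n μ ν = proj R n (substFree l μ fun i => incl R (m i) (ν i)) := by
  induction μ using Finsupp.induction_linear with
  | zero => simp
  | add μ μ' hμ hμ' => simp [hμ, hμ']
  | single t c =>
    rw [substFree_single, map_smul, comp, Finsupp.linearCombination_single]
    rfl

theorem comp_eq_zero {l : ℕ} (m : Fin l → ℕ) {n : ℕ} (h : ∑ i, m i ≠ n) (μ : Free R α l)
    (ν : ∀ i, Free R α (m i)) : comp R m n μ ν = 0 := by
  rw [comp_eq_proj, proj_of_ne h (substFree_mem_homog m μ fun i => incl_mem_homog (ν i))]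

theorem incl_comp {l : ℕ} (m : Fin l → ℕ) {n : ℕ} (h : ∑ i, m i = n) (μ : Free R α l)
    (ν : ∀ i, Free R α (m i)) :
    incl R n (comp R m n μ ν) = substFree l μ fun i => incl R (m i) (ν i) := by
  subst h
  rw [comp_eq_proj, incl_proj (substFree_mem_homog m μ fun i => incl_mem_homog (ν i))]

end Substitution

section Evaluation

variable {R : Type w} [CommRing R] {α : Type u} {A : Type v} [AddCommGroup A] [Module R A]
  (B : α → A →ₗ[R] A →ₗ[R] A)

/-- The value of a monomial at `y 0, y 1, …` in the algebra `A` with bilinear operations `B`. -/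
def evalTree : BTree α → (ℕ → A) → A
  | .leaf, y => y 0
  | .node a s t, y => B a (evalTree s y) (evalTree t fun i => y (s.leaves + i))

/-- The linear extension of `evalTree` to combinations of monomials of all arities. -/
def evalTotal (y : ℕ → A) : Total R α →ₗ[R] A :=
  Finsupp.linearCombination R fun t => evalTree B t y

theorem evalTotal_single (y : ℕ → A) (t : BTree α) (c : R) :
    evalTotal B y (Finsupp.single t c) = c • evalTree B t y := by
  simp [evalTotal]

theorem evalTotal_mul (a : α) (y : ℕ → A) {p : ℕ} {x : Total R α} (hx : x ∈ homog R α p)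
    (z : Total R α) :
    evalTotal B y (mul R a x z) =
      B a (evalTotal B y x) (evalTotal B (fun i => y (p + i)) z) := by
  obtain ⟨x, rfl⟩ := hx
  induction x using Finsupp.induction_linear with
  | zero => simp
  | add x x' hx hx' => simp [hx, hx']
  | single s b =>
    induction z using Finsupp.induction_linear with
    | zero => simp
    | add z z' hz hz' => simp [hz, hz']
    | single t c =>
      obtain ⟨s, rfl⟩ := s
      simp only [incl_single, mul_single_single, evalTotal_single, evalTree, mul_smul, map_smul,
        LinearMap.smul_apply]
      rw [smul_comm]

theorem evalTotal_const_mul (a : α) (y : A) (x z : Total R α) :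
    evalTotal B (fun _ => y) (mul R a x z) =
      B a (evalTotal B (fun _ => y) x) (evalTotal B (fun _ => y) z) := by
  induction x using Finsupp.induction_linear with
  | zero => simp
  | add x x' hx hx' => simp [hx, hx']
  | single s b => exact evalTotal_mul B a _ (single_mem_homog s b) z

theorem evalTree_mul_eq_substFun (t : BTree α) (y : ℕ → Total R α) :
    evalTree (mul R) t y = substFun R t fun i => y i := by
  induction t generalizing y with
  | leaf => rfl
  | node a s t hs ht =>
    rw [evalTree, hs, ht]
    rfl

theorem evalTotal_mul_incl {l : ℕ} (μ : Free R α l) (y : ℕ → Total R α) :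
    evalTotal (mul R) y (incl R l μ) = substFree l μ fun i => y i := by
  induction μ using Finsupp.induction_linear with
  | zero => simp
  | add μ μ' hμ hμ' => simp [hμ, hμ']
  | single t c =>
    obtain ⟨t, rfl⟩ := t
    rw [incl_single, evalTotal_single, evalTree_mul_eq_substFun, substFree_single]
    rfl

end Evaluation

section TotalIdeal

variable {R : Type w} [CommRing R] {α : Type u}

theorem eq_leaf_of_leaves_eq_one {t : BTree α} (h : t.leaves = 1) : t = .leaf := by
  cases t with
  | leaf => rfl
  | node _ s t =>
    have := s.leaves_pos
    have := t.leaves_pos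
    simp only [BTree.leaves] at h
    omega

theorem exists_eq_node_leaf_leaf {t : BTree α} (h : t.leaves = 2) :
    ∃ p, t = .node p .leaf .leaf := by
  cases t with
  | leaf => simp [BTree.leaves] at h
  | node p s t =>
    have := s.leaves_pos
    have := t.leaves_pos
    simp only [BTree.leaves] at h
    rw [eq_leaf_of_leaves_eq_one (show s.leaves = 1 by omega),
      eq_leaf_of_leaves_eq_one (show t.leaves = 1 by omega)]
    exact ⟨p, rfl⟩

theorem eq_leftTree_or_eq_rightTree (t : TreeN α 3) :
    ∃ p q, t = leftTree p q ∨ t = rightTree p q := by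
  obtain ⟨t, h⟩ := t
  cases t with
  | leaf => simp [BTree.leaves] at h
  | node p s t =>
    have := s.leaves_pos
    have := t.leaves_pos
    have hst : s.leaves + t.leaves = 3 := h
    obtain hs | hs : s.leaves = 1 ∨ s.leaves = 2 := by omega
    · obtain rfl := eq_leaf_of_leaves_eq_one hs
      obtain ⟨q, rfl⟩ := exists_eq_node_leaf_leaf (show t.leaves = 2 by omega)
      exact ⟨p, q, .inr rfl⟩
    · obtain ⟨q, rfl⟩ := exists_eq_node_leaf_leaf hs
      obtain rfl := eq_leaf_of_leaves_eq_one (show t.leaves = 1 by omega)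
      exact ⟨p, q, .inl rfl⟩

/-- A subspace of the sum of all components closed under multiplication, by all the generating
operations, with arbitrary elements on either side. -/
structure IsMulIdeal (K : Submodule R (Total R α)) : Prop where
  mul_left : ∀ (a : α) {x : Total R α} (y : Total R α), x ∈ K → mul R a x y ∈ K
  mul_right : ∀ (a : α) (x : Total R α) {y : Total R α}, y ∈ K → mul R a x y ∈ K

/-- The consequences of arity `n` of the quadratic relations `S` that are obtained from a relation
by substituting monomials for its variables and multiplying with monomials. -/
inductive IsConsequence (S : Submodule R (Free R α 3)) : ℕ → Total R α → Prop
  | rel {r : Free R α 3} (hr : r ∈ S) (s t u : BTree α) :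
      IsConsequence S (s.leaves + t.leaves + u.leaves)
        (substFree 3 r ![Finsupp.single s 1, Finsupp.single t 1, Finsupp.single u 1])
  | mul_left {n : ℕ} {x : Total R α} (a : α) (hx : IsConsequence S n x) (t : BTree α) :
      IsConsequence S (n + t.leaves) (mul R a x (Finsupp.single t 1))
  | mul_right {n : ℕ} {x : Total R α} (a : α) (s : BTree α) (hx : IsConsequence S n x) :
      IsConsequence S (s.leaves + n) (mul R a (Finsupp.single s 1) x)

/-- The sum of all components of the operad ideal generated by `S` (see `mem_ideal_iff`). -/
def totalIdeal (S : Submodule R (Free R α 3)) : Submodule R (Total R α) :=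
  Submodule.span R {x | ∃ n, IsConsequence S n x}

variable {S : Submodule R (Free R α 3)}

theorem IsConsequence.mem_totalIdeal {n : ℕ} {x : Total R α} (hx : IsConsequence S n x) :
    x ∈ totalIdeal S :=
  Submodule.subset_span ⟨n, hx⟩

theorem isMulIdeal_totalIdeal (S : Submodule R (Free R α 3)) : IsMulIdeal (totalIdeal S) where
  mul_left a x y hx := by
    induction y using Finsupp.induction_linear with
    | zero => simp
    | add y y' hy hy' => simpa using add_mem hy hy'
    | single t c =>
      rw [← mul_one c, ← smul_eq_mul, ← Finsupp.smul_single, map_smul]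
      refine Submodule.smul_mem _ c ?_
      refine Submodule.span_le (p := (totalIdeal S).comap
        ((mul R a).flip (Finsupp.single t 1))).2 ?_ hx
      rintro x ⟨n, hx⟩
      exact (hx.mul_left a t).mem_totalIdeal
  mul_right a x y hy := by
    induction x using Finsupp.induction_linear with
    | zero => simp
    | add x x' hx hx' => simpa using add_mem hx hx'
    | single s c =>
      rw [← mul_one c, ← smul_eq_mul, ← Finsupp.smul_single, map_smul, LinearMap.smul_apply]
      refine Submodule.smul_mem _ c ?_
      refine Submodule.span_le (p := (totalIdeal S).comap (mul R a (Finsupp.single s 1))).2 ?_ hy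
      rintro y ⟨n, hy⟩
      exact (hy.mul_right a s).mem_totalIdeal

theorem substFree_mem_totalIdeal {r : Free R α 3} (hr : r ∈ S) (x : Fin 3 → Total R α) :
    substFree 3 r x ∈ totalIdeal S := by
  have hzero : (totalIdeal S).mkQ.compMultilinearMap (substFree 3 r) = 0 := by
    refine Module.Basis.ext_multilinear (fun _ => Finsupp.basisSingleOne) fun v => ?_
    have hv : (fun i => Finsupp.basisSingleOne (v i) : Fin 3 → Total R α) =
        ![Finsupp.single (v 0) 1, Finsupp.single (v 1) 1, Finsupp.single (v 2) 1] := by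
      ext i : 1
      fin_cases i <;> simp
    simpa only [LinearMap.compMultilinearMap_apply, hv, Submodule.mkQ_apply,
      zero_apply, Submodule.Quotient.mk_eq_zero] using
      (IsConsequence.rel hr (v 0) (v 1) (v 2)).mem_totalIdeal
  simpa using congrArg (fun g => g x) hzero

theorem totalIdeal_le {K : Submodule R (Total R α)} (hK : IsMulIdeal K)
    (hS : ∀ r ∈ S, ∀ x y z, substFree 3 r ![x, y, z] ∈ K) : totalIdeal S ≤ K := by
  refine Submodule.span_le.2 ?_
  rintro x ⟨n, hx⟩
  induction hx with
  | rel hr s t u => exact hS _ hr _ _ _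
  | mul_left a _ t ih => exact hK.mul_left a _ ih
  | mul_right a s _ ih => exact hK.mul_right a _ ih

theorem evalTotal_mul_substFree_three (r : Free R α 3) (s t u : BTree α) (y : ℕ → Total R α) :
    evalTotal (mul R) y
        (substFree 3 r ![Finsupp.single s 1, Finsupp.single t 1, Finsupp.single u 1]) =
      substFree 3 r ![evalTree (mul R) s y, evalTree (mul R) t fun i => y (s.leaves + i),
        evalTree (mul R) u fun i => y (s.leaves + t.leaves + i)] := by
  induction r using Finsupp.induction_linear with
  | zero => simp
  | add r r' hr hr' => simp [hr, hr']
  | single m c =>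
    rw [← mul_one c, ← smul_eq_mul, ← Finsupp.smul_single, map_smul]
    obtain ⟨p, q, rfl | rfl⟩ := eq_leftTree_or_eq_rightTree m
    · change evalTotal (mul R) y ((c • substFree 3 (leftMon R p q)) _) =
        (c • substFree 3 (leftMon R p q)) _
      simp only [smul_apply, substFree_leftMon, mul_single_single, mul_one, map_smul,
        evalTotal_single, one_smul]
      rfl
    · change evalTotal (mul R) y ((c • substFree 3 (rightMon R p q)) _) =
        (c • substFree 3 (rightMon R p q)) _
      simp only [smul_apply, substFree_rightMon, mul_single_single, mul_one, map_smul,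
        evalTotal_single, one_smul, evalTree, add_assoc]

theorem IsConsequence.mem_homog {n : ℕ} {x : Total R α} (hx : IsConsequence S n x) :
    x ∈ homog R α n := by
  induction hx with
  | @rel r _ s t u =>
    have := substFree_mem_homog ![s.leaves, t.leaves, u.leaves] r
      (x := ![Finsupp.single s 1, Finsupp.single t 1, Finsupp.single u 1])
      fun i => by fin_cases i <;> exact single_mem_homog _ _
    rwa [Fin.sum_univ_three] at this
  | mul_left a _ t ih => exact mul_mem_homog a ih (single_mem_homog t 1)
  | mul_right a s _ ih => exact mul_mem_homog a (single_mem_homog s 1) ih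

theorem IsConsequence.evalTotal_mem {n : ℕ} {x : Total R α} (hx : IsConsequence S n x)
    (y : ℕ → Total R α) : evalTotal (mul R) y x ∈ totalIdeal S := by
  induction hx generalizing y with
  | rel hr s t u =>
    rw [evalTotal_mul_substFree_three]
    exact substFree_mem_totalIdeal hr _
  | mul_left a hx t ih =>
    rw [evalTotal_mul _ a y hx.mem_homog]
    exact (isMulIdeal_totalIdeal S).mul_left a _ (ih y)
  | mul_right a s _ ih =>
    rw [evalTotal_mul _ a y (single_mem_homog s 1)]
    exact (isMulIdeal_totalIdeal S).mul_right a _ (ih _)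

theorem evalTotal_mem_totalIdeal {x : Total R α} (hx : x ∈ totalIdeal S) (y : ℕ → Total R α) :
    evalTotal (mul R) y x ∈ totalIdeal S := by
  refine Submodule.span_le (p := (totalIdeal S).comap (evalTotal (mul R) y)).2 ?_ hx
  rintro x ⟨n, hx⟩
  exact hx.evalTotal_mem y

theorem IsMulIdeal.substFun_mem {K : Submodule R (Total R α)} (hK : IsMulIdeal K) (t : BTree α)
    (x : Fin t.leaves → Total R α) (i : Fin t.leaves) (hi : x i ∈ K) : substFun R t x ∈ K := by
  induction t with
  | leaf =>
    obtain rfl : i = (0 : Fin 1) := Subsingleton.elim (α := Fin 1) _ _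
    exact hi
  | node a s t hs ht =>
    change Fin (s.leaves + t.leaves) at i
    induction i using Fin.addCases with
    | left i => exact hK.mul_left a _ (hs _ i hi)
    | right i => exact hK.mul_right a _ (ht _ i hi)

theorem IsMulIdeal.substFree_mem {K : Submodule R (Total R α)} (hK : IsMulIdeal K) {l : ℕ}
    (μ : Free R α l) (x : Fin l → Total R α) (i : Fin l) (hi : x i ∈ K) : substFree l μ x ∈ K := by
  induction μ using Finsupp.induction_linear with
  | zero => simp
  | add μ μ' hμ hμ' => simpa using add_mem hμ hμ'
  | single t c =>
    obtain ⟨t, rfl⟩ := t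
    rw [substFree_single]
    exact Submodule.smul_mem _ c (hK.substFun_mem t _ i hi)

theorem isIdeal_comap_totalIdeal (S : Submodule R (Free R α 3)) :
    IsIdeal fun n => (totalIdeal S).comap (incl R n) where
  outer {l} m n μ ν hμ := by
    by_cases h : ∑ i, m i = n
    · have := evalTotal_mem_totalIdeal hμ fun i => if hi : i < l then incl R _ (ν ⟨i, hi⟩) else 0
      rw [evalTotal_mul_incl] at this
      rw [Submodule.mem_comap, incl_comp m h]
      simpa using this
    · rw [comp_eq_zero m h]
      exact zero_mem _
  inner m n μ ν i hi := by
    by_cases h : ∑ i, m i = n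
    · rw [Submodule.mem_comap, incl_comp m h]
      exact (isMulIdeal_totalIdeal S).substFree_mem μ _ i hi
    · rw [comp_eq_zero m h]
      exact zero_mem _

theorem substFun_leaf (t : BTree α) :
    substFun R t (fun _ => Finsupp.single .leaf 1) = Finsupp.single t 1 := by
  induction t with
  | leaf => rfl
  | node a s t hs ht => rw [substFun, hs, ht, mul_single_single, mul_one]

theorem substFree_leaf {l : ℕ} (μ : Free R α l) :
    substFree l μ (fun _ => Finsupp.single .leaf 1) = incl R l μ := by
  induction μ using Finsupp.induction_linear with
  | zero => simp
  | add μ μ' hμ hμ' => simp [hμ, hμ']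
  | single t c => rw [substFree_single, substFun_leaf, incl_single, Finsupp.smul_single_one]

theorem le_comap_totalIdeal (S : Submodule R (Free R α 3)) :
    S ≤ (totalIdeal S).comap (incl R 3) := by
  intro r hr
  rw [Submodule.mem_comap, ← substFree_leaf]
  exact substFree_mem_totalIdeal hr _

theorem proj_mul_mem_ideal (a : α) {p q : ℕ} (x : Free R α p) (y : Free R α q)
    (h : x ∈ ideal S p ∨ y ∈ ideal S q) :
    proj R (p + q) (mul R a (incl R p x) (incl R q y)) ∈ ideal S (p + q) := by
  let ν : ∀ i, Free R α (![p, q] i) := Fin.cons x (Fin.cons y finZeroElim)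
  have hcomp : comp R ![p, q] (p + q) (Finsupp.single ⟨.node a .leaf .leaf, rfl⟩ 1) ν =
      proj R (p + q) (mul R a (incl R p x) (incl R q y)) := by
    rw [comp_eq_proj, substFree_single, one_smul]
    rfl
  rw [← hcomp]
  obtain hx | hy := h
  · exact (isIdeal_ideal S).inner _ _ _ ν 0 hx
  · exact (isIdeal_ideal S).inner _ _ _ ν 1 hy

theorem IsConsequence.proj_mem_ideal {n : ℕ} {x : Total R α} (hx : IsConsequence S n x) :
    proj R n x ∈ ideal S n := by
  induction hx with
  | @rel r hr s t u =>
    let ν : ∀ i, Free R α (![s.leaves, t.leaves, u.leaves] i) :=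
      Fin.cons (Finsupp.single ⟨s, rfl⟩ 1)
        (Fin.cons (Finsupp.single ⟨t, rfl⟩ 1) (Fin.cons (Finsupp.single ⟨u, rfl⟩ 1) finZeroElim))
    have hν : (fun i => incl R _ (ν i)) =
        ![Finsupp.single s 1, Finsupp.single t 1, Finsupp.single u 1] := by
      ext i : 1
      fin_cases i <;> exact incl_single _ _
    have := (isIdeal_ideal S).outer _ (s.leaves + t.leaves + u.leaves) r ν (le_ideal S hr)
    rwa [comp_eq_proj, hν] at this
  | @mul_left n x a hx t ih =>
    have := proj_mul_mem_ideal (S := S) a (proj R n x) (Finsupp.single ⟨t, rfl⟩ 1) (.inl ih)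
    rwa [incl_proj hx.mem_homog, incl_single] at this
  | @mul_right n x a s hx ih =>
    have := proj_mul_mem_ideal (S := S) a (Finsupp.single ⟨s, rfl⟩ 1) (proj R n x) (.inr ih)
    rwa [incl_proj hx.mem_homog, incl_single] at this

theorem proj_mem_ideal {x : Total R α} (hx : x ∈ totalIdeal S) (n : ℕ) :
    proj R n x ∈ ideal S n := by
  refine Submodule.span_le (p := (ideal S n).comap (proj R n)).2 ?_ hx
  rintro x ⟨m, hx⟩
  by_cases h : m = n
  · exact h ▸ hx.proj_mem_ideal
  · rw [SetLike.mem_coe, Submodule.mem_comap, proj_of_ne h hx.mem_homog]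
    exact zero_mem _

theorem mem_ideal_iff {n : ℕ} {x : Free R α n} : x ∈ ideal S n ↔ incl R n x ∈ totalIdeal S := by
  refine ⟨fun hx => mem_ideal.1 hx _ (isIdeal_comap_totalIdeal S) (le_comap_totalIdeal S),
    fun hx => ?_⟩
  simpa only [proj_incl] using proj_mem_ideal hx n

theorem mk_eq_mk_iff {n : ℕ} {x y : Free R α n} :
    (Submodule.Quotient.mk x : Operad S n) = Submodule.Quotient.mk y ↔
      incl R n x - incl R n y ∈ totalIdeal S := by
  rw [Submodule.Quotient.eq, mem_ideal_iff, map_sub]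

end TotalIdeal

section NormalMonomials

variable {R : Type w} [CommRing R] {α : Type u} {β : Type v}

/-- `IsNormal l t` says that no operation from `β` occurs below an operation from `α` in the
monomial `t`, and that the maximal submonomials of `t` in the operations `α` have arities `l`, read
from left to right. These are the monomials `μ(ν₁, …, ν_l)` met by the map `ξ`. -/
inductive IsNormal : List ℕ → BTree (α ⊕ β) → Prop
  | inner (t : BTree α) : IsNormal [t.leaves] (t.map Sum.inl)
  | outer (b : β) {l l' : List ℕ} {s t : BTree (α ⊕ β)} (hs : IsNormal l s) (ht : IsNormal l' t) :
      IsNormal (l ++ l') (.node (Sum.inr b) s t)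

theorem IsNormal.exists_eq_substFun (R : Type w) [CommRing R] {l : List ℕ} {t : BTree (α ⊕ β)}
    (ht : IsNormal l t) :
    ∃ (u : BTree β) (x : Fin u.leaves → BTree α), List.ofFn (fun i => (x i).leaves) = l ∧
      substFun R (u.map Sum.inr) (fun i => Finsupp.single
        ((x (finCongr (BTree.leaves_map Sum.inr u) i)).map Sum.inl : BTree (α ⊕ β)) 1) =
        Finsupp.single t 1 := by
  induction ht with
  | inner t => exact ⟨.leaf, fun _ => t, rfl, rfl⟩
  | outer b hs ht ihs iht =>
    obtain ⟨u, x, rfl, hx⟩ := ihs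
    obtain ⟨v, y, rfl, hy⟩ := iht
    let g (z : BTree α) : Total R (α ⊕ β) := Finsupp.single (z.map Sum.inl) 1
    refine ⟨.node b u v, Fin.append x y, ?_, ?_⟩
    · rw [← List.ofFn_fin_append]
      congr 1
      funext i
      change Fin (u.leaves + v.leaves) at i
      induction i using Fin.addCases with
      | left i => simp
      | right i => simp
    · rw [← mul_one (1 : R), ← mul_single_single, mul_one, ← hx, ← hy]
      refine congrArg₂ (fun a b' => mul R (Sum.inr b) a b') (congrArg _ ?_) (congrArg _ ?_)
      · funext i
        exact congrArg g (Fin.append_left x y (finCongr (BTree.leaves_map Sum.inr u) i))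
      · funext i
        refine congrArg g ((congrArg (Fin.append x y) (Fin.ext ?_)).trans
          (Fin.append_right x y (finCongr (BTree.leaves_map Sum.inr v) i)))
        exact congrArg (· + (i : ℕ)) (BTree.leaves_map Sum.inr u)

theorem IsNormal.leaves_eq {l : List ℕ} {t : BTree (α ⊕ β)} (ht : IsNormal l t) :
    t.leaves = l.sum := by
  induction ht with
  | inner t => simp [BTree.leaves_map]
  | outer b _ _ ihs iht => simp [BTree.leaves, ihs, iht]

theorem IsNormal.pos {l : List ℕ} {t : BTree (α ⊕ β)} (ht : IsNormal l t) : ∀ i ∈ l, 0 < i := by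
  induction ht with
  | inner t => simpa using t.leaves_pos
  | outer b _ _ ihs iht => simpa [or_imp, forall_and] using ⟨ihs, iht⟩

/-- The generator of `P₂ ∘ P₁` given by a monomial `u` in the operations `β` and monomials `x i` in
the operations `α`. -/
def compositeMon (R₁ : Submodule R (Free R α 3)) (R₂ : Submodule R (Free R β 3)) {n : ℕ}
    (c : Composition n) (u : TreeN β c.length) (x : ∀ i, TreeN α (c.blocksFun i)) :
    Composite R₁ R₂ n :=
  DirectSum.lof R (Composition n) _ c
    (Submodule.Quotient.mk (Finsupp.single u 1) ⊗ₜ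
      PiTensorProduct.tprod R fun i => Submodule.Quotient.mk (Finsupp.single (x i) 1))

theorem xi_compositeMon (R₁ : Submodule R (Free R α 3)) (R₂ : Submodule R (Free R β 3))
    (D : F12 R α β →ₗ[R] F21 R α β) {n : ℕ} (c : Composition n) (u : TreeN β c.length)
    (x : ∀ i, TreeN α (c.blocksFun i)) :
    xi R₁ R₂ D n (compositeMon R₁ R₂ c u x) =
      Submodule.Quotient.mk (comp R c.blocksFun n (freeMap R Sum.inr _ (Finsupp.single u 1))
        fun i => freeMap R Sum.inl _ (Finsupp.single (x i) 1)) := by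
  rw [← compQ_mk]
  simp only [xi, compositeMon, DirectSum.toModule_lof, TensorProduct.lift.tmul,
    LinearMap.comp_apply, LinearEquiv.coe_coe, MultilinearMap.compLinearMapₗ_apply,
    PiTensorProduct.lift.tprod, MultilinearMap.compLinearMap_apply]
  rfl

theorem IsNormal.exists_xi_compositeMon_eq (R₁ : Submodule R (Free R α 3))
    (R₂ : Submodule R (Free R β 3)) (D : F12 R α β →ₗ[R] F21 R α β) {n : ℕ} (c : Composition n)
    {t : TreeN (α ⊕ β) n} (ht : IsNormal c.blocks t.1) :
    ∃ u x, xi R₁ R₂ D n (compositeMon R₁ R₂ c u x) =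
      Submodule.Quotient.mk (Finsupp.single t 1) := by
  obtain ⟨u, x, hl, hx⟩ := ht.exists_eq_substFun R
  have hu : u.leaves = c.length := by rw [Composition.length, ← hl, List.length_ofFn]
  have hxc (i : Fin c.length) : (x (Fin.cast hu.symm i)).leaves = c.blocksFun i := by
    simp [Composition.blocksFun, ← hl, Fin.cast]
  refine ⟨⟨u, hu⟩, fun i => ⟨x (Fin.cast hu.symm i), hxc i⟩, ?_⟩
  rw [xi_compositeMon, comp_eq_proj]
  have hproj := congrArg (proj R n) hx
  rw [proj_single, dif_pos t.2] at hproj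
  rw [← hproj]
  simp only [freeMap, Finsupp.lmapDomain_apply, Finsupp.mapDomain_single, substFree_single,
    one_smul, incl_single]
  rfl

end NormalMonomials

section Surjectivity

variable {R : Type w} [CommRing R] {α : Type u} {β : Type v}
  (S : Submodule R (Free R (α ⊕ β) 3))

/-- The elements that are congruent, modulo the relations `S`, to combinations of normal
monomials. -/
def normalSpan : Submodule R (Total R (α ⊕ β)) :=
  totalIdeal S ⊔ Submodule.span R {x | ∃ l t, IsNormal l t ∧ Finsupp.single t 1 = x}

variable {S}

theorem mem_normalSpan_of_mem_totalIdeal {x : Total R (α ⊕ β)} (hx : x ∈ totalIdeal S) :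
    x ∈ normalSpan S :=
  Submodule.mem_sup_left hx

theorem IsNormal.mem_normalSpan {l : List ℕ} {t : BTree (α ⊕ β)} (ht : IsNormal l t) :
    Finsupp.single t 1 ∈ normalSpan S :=
  Submodule.mem_sup_right (Submodule.subset_span ⟨l, t, ht, rfl⟩)

theorem mul_mem_normalSpan {a : α ⊕ β} {x y : Total R (α ⊕ β)}
    (hx : x ∈ normalSpan S) (hy : y ∈ normalSpan S)
    (h : ∀ l l' s t, IsNormal l s → IsNormal l' t →
      mul R a (Finsupp.single s 1) (Finsupp.single t 1) ∈ normalSpan S) :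
    mul R a x y ∈ normalSpan S := by
  obtain ⟨x₀, hx₀, x, hx', rfl⟩ := Submodule.mem_sup.1 hx
  obtain ⟨y₀, hy₀, y, hy', rfl⟩ := Submodule.mem_sup.1 hy
  have hxy : mul R a x y ∈ normalSpan S := by
    refine Submodule.span_le.2 ?_
      (Submodule.map₂_span_span R (mul R a) _ _ ▸ Submodule.apply_mem_map₂ (mul R a) hx' hy')
    rintro _ ⟨_, ⟨l, s, hs, rfl⟩, _, ⟨l', t, ht, rfl⟩, rfl⟩
    exact h l l' s t hs ht
  rw [LinearMap.map_add₂, map_add (mul R a x)]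
  exact add_mem
    (mem_normalSpan_of_mem_totalIdeal ((isMulIdeal_totalIdeal S).mul_left a _ hx₀))
    (add_mem (mem_normalSpan_of_mem_totalIdeal ((isMulIdeal_totalIdeal S).mul_right a x hy₀)) hxy)

theorem mul_inr_mem_normalSpan (b : β) {x y : Total R (α ⊕ β)}
    (hx : x ∈ normalSpan S) (hy : y ∈ normalSpan S) : mul R (Sum.inr b) x y ∈ normalSpan S :=
  mul_mem_normalSpan hx hy fun _ _ _ _ hs ht => by
    rw [mul_single_single, mul_one]
    exact (hs.outer b ht).mem_normalSpan

theorem substFree_F21_mem_normalSpan {r : Free R (α ⊕ β) 3} (hr : r ∈ F21 R α β)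
    {x y z : Total R (α ⊕ β)} (hx : x ∈ normalSpan S) (hz : z ∈ normalSpan S)
    (hxy : ∀ a, mul R (Sum.inl a) x y ∈ normalSpan S)
    (hyz : ∀ a, mul R (Sum.inl a) y z ∈ normalSpan S) :
    substFree 3 r ![x, y, z] ∈ normalSpan S := by
  induction hr using Submodule.span_induction with
  | zero => simp
  | add r r' _ _ hr hr' => simpa using add_mem hr hr'
  | smul c r _ hr => simpa using Submodule.smul_mem _ c hr
  | mem r hr =>
    obtain ⟨_, ⟨b, rfl⟩, _, ⟨a, rfl⟩, rfl | rfl⟩ := hr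
    · rw [substFree_leftMon]
      exact mul_inr_mem_normalSpan b (hxy a) hz
    · rw [substFree_rightMon]
      exact mul_inr_mem_normalSpan b hx (hyz a)

theorem sub_mem_combinedRel (R₁ : Submodule R (Free R α 3)) (R₂ : Submodule R (Free R β 3))
    (D : F12 R α β →ₗ[R] F21 R α β) (x : F12 R α β) :
    (x : Free R (α ⊕ β) 3) - D x ∈ combinedRel R₁ R₂ D :=
  Submodule.mem_sup_left (Submodule.mem_sup_right (Submodule.subset_span ⟨x, rfl⟩))

variable {R₁ : Submodule R (Free R α 3)} {R₂ : Submodule R (Free R β 3)}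
  {D : F12 R α β →ₗ[R] F21 R α β}

theorem substFree_F12_mem_normalSpan (r : F12 R α β) {x y z : Total R (α ⊕ β)}
    (hx : x ∈ normalSpan (combinedRel R₁ R₂ D)) (hz : z ∈ normalSpan (combinedRel R₁ R₂ D))
    (hxy : ∀ a, mul R (Sum.inl a) x y ∈ normalSpan (combinedRel R₁ R₂ D))
    (hyz : ∀ a, mul R (Sum.inl a) y z ∈ normalSpan (combinedRel R₁ R₂ D)) :
    substFree 3 (r : Free R (α ⊕ β) 3) ![x, y, z] ∈ normalSpan (combinedRel R₁ R₂ D) := by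
  have h := add_mem (mem_normalSpan_of_mem_totalIdeal
      (substFree_mem_totalIdeal (sub_mem_combinedRel R₁ R₂ D r) ![x, y, z]))
    (substFree_F21_mem_normalSpan (D r).2 hx hz hxy hyz)
  rwa [map_sub, sub_apply, sub_add_cancel] at h

theorem mul_inl_mem_normalSpan_of_isNormal (a : α) {l l' : List ℕ} {s t : BTree (α ⊕ β)}
    (hs : IsNormal l s) (ht : IsNormal l' t) :
    mul R (Sum.inl a) (Finsupp.single s 1) (Finsupp.single t 1) ∈
      normalSpan (combinedRel R₁ R₂ D) := by
  induction hn : s.leaves + t.leaves using Nat.strong_induction_on generalizing a l l' s t with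
  | _ n ih =>
    subst hn
    cases hs with
    | @outer b _ _ s₁ s₂ hs₁ hs₂ =>
      have := s₁.leaves_pos
      have := t.leaves_pos
      have h := substFree_F12_mem_normalSpan (R₁ := R₁) (R₂ := R₂) (D := D)
        ⟨leftMon R (Sum.inl a) (Sum.inr b),
          Submodule.subset_span ⟨_, ⟨a, rfl⟩, _, ⟨b, rfl⟩, .inl rfl⟩⟩
        hs₁.mem_normalSpan ht.mem_normalSpan
        (fun a => ih _ (by simp only [BTree.leaves]; omega) a hs₁ hs₂ rfl)
        (fun a => ih _ (by simp only [BTree.leaves]; omega) a hs₂ ht rfl)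
      rwa [substFree_leftMon, mul_single_single (Sum.inr b), mul_one] at h
    | inner s =>
      cases ht with
      | @outer b _ _ t₁ t₂ ht₁ ht₂ =>
        have := (s.map Sum.inl : BTree (α ⊕ β)).leaves_pos
        have := t₂.leaves_pos
        have h := substFree_F12_mem_normalSpan (R₁ := R₁) (R₂ := R₂) (D := D)
          ⟨rightMon R (Sum.inl a) (Sum.inr b),
            Submodule.subset_span ⟨_, ⟨a, rfl⟩, _, ⟨b, rfl⟩, .inr rfl⟩⟩
          (IsNormal.inner s).mem_normalSpan ht₂.mem_normalSpan
          (fun a => ih _ (by simp only [BTree.leaves]; omega) a (.inner s) ht₁ rfl)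
          (fun a => ih _ (by simp only [BTree.leaves]; omega) a ht₁ ht₂ rfl)
        rwa [substFree_rightMon, mul_single_single (Sum.inr b), mul_one] at h
      | inner t =>
        rw [mul_single_single, mul_one]
        exact (IsNormal.inner (.node a s t)).mem_normalSpan

variable (R₁ R₂ D)

theorem normalSpan_combinedRel_eq_top : normalSpan (combinedRel R₁ R₂ D) = ⊤ := by
  rw [eq_top_iff]
  rintro x -
  induction x using Finsupp.induction_linear with
  | zero => exact zero_mem _
  | add x y hx hy => exact add_mem hx hy
  | single t c =>
    rw [← mul_one c, ← smul_eq_mul, ← Finsupp.smul_single]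
    refine Submodule.smul_mem _ c ?_
    induction t with
    | leaf => exact (IsNormal.inner .leaf).mem_normalSpan
    | node p s t hs ht =>
      rw [← mul_one (1 : R), ← mul_single_single]
      cases p with
      | inl a => exact mul_mem_normalSpan hs ht fun _ _ _ _ hs ht =>
          mul_inl_mem_normalSpan_of_isNormal a hs ht
      | inr b => exact mul_inr_mem_normalSpan b hs ht

theorem IsNormal.mk_mem_range_xi {l : List ℕ} {n : ℕ} {t : TreeN (α ⊕ β) n}
    (ht : IsNormal l t.1) :
    Submodule.Quotient.mk (Finsupp.single t 1) ∈ LinearMap.range (xi R₁ R₂ D n) := by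
  let c : Composition n := ⟨l, fun h => ht.pos _ h, ht.leaves_eq.symm.trans t.2⟩
  obtain ⟨u, x, h⟩ := IsNormal.exists_xi_compositeMon_eq R₁ R₂ D c ht
  exact ⟨_, h⟩

theorem xi_surjective (n : ℕ) : Function.Surjective (xi R₁ R₂ D n) := by
  intro z
  obtain ⟨x, rfl⟩ := Submodule.Quotient.mk_surjective _ z
  have htop : normalSpan (combinedRel R₁ R₂ D) ≤ (LinearMap.range (xi R₁ R₂ D n)).comap
      ((ideal (combinedRel R₁ R₂ D) n).mkQ ∘ₗ proj R n) := by
    refine sup_le (fun y hy => ?_) (Submodule.span_le.2 ?_)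
    · rw [Submodule.mem_comap, LinearMap.comp_apply, Submodule.mkQ_apply,
        (Submodule.Quotient.mk_eq_zero _).2 (proj_mem_ideal hy n)]
      exact zero_mem _
    · rintro _ ⟨l, t, ht, rfl⟩
      rw [SetLike.mem_coe, Submodule.mem_comap, LinearMap.comp_apply, Submodule.mkQ_apply,
        proj_single]
      split_ifs with h
      · exact IsNormal.mk_mem_range_xi R₁ R₂ D (t := ⟨t, h⟩) ht
      · exact zero_mem _
  rw [normalSpan_combinedRel_eq_top] at htop
  simpa [proj_incl] using htop (Submodule.mem_top (x := incl R n x))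

end Surjectivity

section Associative

variable {R : Type w} [CommRing R] {α : Type u} {β : Type v}

theorem isMulIdeal_ker_evalTotal_const {A : Type v} [AddCommGroup A] [Module R A]
    (B : α → A →ₗ[R] A →ₗ[R] A) (y : A) :
    IsMulIdeal (LinearMap.ker (evalTotal B fun _ => y)) where
  mul_left a x z hx := by
    rw [LinearMap.mem_ker] at hx ⊢
    rw [evalTotal_const_mul, hx, map_zero, LinearMap.zero_apply]
  mul_right a x z hz := by
    rw [LinearMap.mem_ker] at hz ⊢
    rw [evalTotal_const_mul, hz, map_zero]

/-- The right comb with `n + 1` leaves and all vertices labelled by `a`. -/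
def rightComb (a : α) : ℕ → BTree α
  | 0 => .leaf
  | n + 1 => .node a .leaf (rightComb a n)

theorem leaves_rightComb (a : α) (n : ℕ) : (rightComb a n).leaves = n + 1 := by
  induction n with
  | zero => rfl
  | succ n ih => simp [rightComb, BTree.leaves, ih, add_comm]

theorem exists_isNormal (a : α) (b : β) {l : List ℕ} (hl : l ≠ []) (hpos : ∀ i ∈ l, 0 < i) :
    ∃ t : BTree (α ⊕ β), IsNormal l t := by
  induction l with
  | nil => exact absurd rfl hl
  | cons i l ih =>
    have hnormal := IsNormal.inner (β := β) (rightComb a (i - 1))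
    rw [leaves_rightComb, Nat.sub_add_cancel (hpos i List.mem_cons_self)] at hnormal
    obtain rfl | hl' := eq_or_ne l []
    · exact ⟨_, hnormal⟩
    · obtain ⟨t, ht⟩ := ih hl' fun j hj => hpos j (List.mem_cons_of_mem i hj)
      exact ⟨_, hnormal.outer b ht⟩

theorem exists_isNormal_blocks (a : α) (b : β) {n : ℕ} (hn : 0 < n) (c : Composition n) :
    ∃ t : TreeN (α ⊕ β) n, IsNormal c.blocks t.1 := by
  have hblocks : c.blocks ≠ [] := fun h => by simpa [h, hn.ne] using c.blocks_sum
  obtain ⟨t, ht⟩ := exists_isNormal a b hblocks fun _ => c.blocks_pos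
  exact ⟨⟨t, ht.leaves_eq.trans c.blocks_sum⟩, ht⟩

variable (R)

theorem mul_assoc_mem_totalIdeal (x y z : Total R Unit) :
    mul R () (mul R () x y) z - mul R () x (mul R () y z) ∈ totalIdeal (assRel R) := by
  have h := substFree_mem_totalIdeal (Submodule.mem_span_singleton_self
    (leftMon R () () - rightMon R () ())) ![x, y, z]
  rwa [map_sub, sub_apply, substFree_leftMon, substFree_rightMon] at h

theorem node_rightComb_sub_mem (p q : ℕ) :
    Finsupp.single (.node () (rightComb () p) (rightComb () q)) 1 -
      Finsupp.single (rightComb () (p + q + 1)) 1 ∈ totalIdeal (assRel R) := by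
  induction p with
  | zero => simp [rightComb]
  | succ p ih =>
    have h := mul_assoc_mem_totalIdeal R (Finsupp.single .leaf 1)
      (Finsupp.single (rightComb () p) 1) (Finsupp.single (rightComb () q) 1)
    have h' := (isMulIdeal_totalIdeal _).mul_right () (Finsupp.single .leaf 1) ih
    rw [show p + 1 + q + 1 = (p + q + 1) + 1 by omega]
    simp only [map_sub, mul_single_single, mul_one, rightComb] at h h' ⊢
    simpa using add_mem h h'

theorem single_sub_rightComb_mem (t : BTree Unit) :
    Finsupp.single t 1 - Finsupp.single (rightComb () (t.leaves - 1)) 1 ∈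
      totalIdeal (assRel R) := by
  induction t with
  | leaf => simp [rightComb, BTree.leaves]
  | node a s t hs ht =>
    have h := (isMulIdeal_totalIdeal _).mul_left () (Finsupp.single t 1) hs
    have h' := (isMulIdeal_totalIdeal _).mul_right ()
      (Finsupp.single (rightComb () (s.leaves - 1)) 1) ht
    have h'' := node_rightComb_sub_mem R (s.leaves - 1) (t.leaves - 1)
    have hleaves : s.leaves - 1 + (t.leaves - 1) + 1 = (BTree.node a s t).leaves - 1 := by
      have := s.leaves_pos
      have := t.leaves_pos
      simp only [BTree.leaves]
      omega
    rw [hleaves] at h''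
    simp only [map_sub, LinearMap.sub_apply, mul_single_single, mul_one] at h h' h''
    simpa using add_mem (add_mem h h') h''

theorem mk_single_eq_mk_single {n : ℕ} (s t : TreeN Unit n) :
    (Submodule.Quotient.mk (Finsupp.single s 1) : Operad (assRel R) n) =
      Submodule.Quotient.mk (Finsupp.single t 1) := by
  rw [mk_eq_mk_iff, incl_single, incl_single]
  have hs := single_sub_rightComb_mem R s.1
  have ht := single_sub_rightComb_mem R t.1
  rw [s.2] at hs
  rw [t.2] at ht
  simpa using sub_mem hs ht

theorem evalTree_mul_one (t : BTree Unit) :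
    evalTree (fun _ => LinearMap.mul R R) t (fun _ => 1) = 1 := by
  induction t with
  | leaf => rfl
  | node _ s t hs ht => simp [evalTree, hs, ht]

theorem totalIdeal_assRel_le_ker :
    totalIdeal (assRel R) ≤ LinearMap.ker (evalTotal (fun _ => LinearMap.mul R R) fun _ => 1) := by
  refine totalIdeal_le (isMulIdeal_ker_evalTotal_const _ _) fun r hr x y z => ?_
  obtain ⟨c, rfl⟩ := Submodule.mem_span_singleton.1 hr
  simp [substFree_leftMon, substFree_rightMon, evalTotal_const_mul, mul_assoc]

/-- The sum of the coefficients of an element of the associative operad. -/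
def assCoeff (n : ℕ) : Operad (assRel R) n →ₗ[R] R :=
  (ideal (assRel R) n).liftQ (evalTotal (fun _ => LinearMap.mul R R) (fun _ => 1) ∘ₗ incl R n)
    fun _ hx => totalIdeal_assRel_le_ker R (mem_ideal_iff.1 hx)

theorem assCoeff_mk_single {n : ℕ} (t : TreeN Unit n) :
    assCoeff R n (Submodule.Quotient.mk (Finsupp.single t 1)) = 1 := by
  change evalTotal _ _ (incl R n (Finsupp.single t 1)) = 1
  rw [incl_single, evalTotal_single, evalTree_mul_one, one_smul]

/-- The components of the associative operad are free of rank one in positive arity. -/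
def assEquiv (n : ℕ) (hn : 1 ≤ n) : Operad (assRel R) n ≃ₗ[R] R :=
  let e : TreeN Unit n :=
    ⟨rightComb () (n - 1), (leaves_rightComb () _).trans (Nat.sub_add_cancel hn)⟩
  LinearEquiv.ofLinearMap (assCoeff R n)
    (LinearMap.toSpanSingleton R _ (Submodule.Quotient.mk (Finsupp.single e 1)))
    (LinearMap.ext_ring (by simp [assCoeff_mk_single]))
    (Submodule.linearMap_qext _ (Finsupp.lhom_ext' fun t => LinearMap.ext_ring (by
      simpa [assCoeff_mk_single] using mk_single_eq_mk_single R e t)))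

theorem assEquiv_mk_single {n : ℕ} (hn : 1 ≤ n) (t : TreeN Unit n) :
    assEquiv R n hn (Submodule.Quotient.mk (Finsupp.single t 1)) = 1 :=
  assCoeff_mk_single R t

/-- The composite of two associative operads is free on the compositions of `n`. -/
def compositeEquiv (n : ℕ) (hn : 1 ≤ n) :
    Composite (assRel R) (assRel R) n ≃ₗ[R] (Composition n → R) :=
  (DFinsupp.mapRange.linearEquiv fun c : Composition n =>
    (TensorProduct.congr (assEquiv R c.length (c.length_pos_of_pos hn))
      ((PiTensorProduct.congr fun i => assEquiv R (c.blocksFun i) (c.one_le_blocksFun i)).trans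
        (PiTensorProduct.constantBaseRingEquiv (Fin c.length) R).toLinearEquiv)).trans
      (TensorProduct.lid R R)).trans
    (DirectSum.linearEquivFunOnFintype R (Composition n) fun _ => R)

theorem compositeEquiv_compositeMon {n : ℕ} (hn : 1 ≤ n) (c : Composition n)
    (u : TreeN Unit c.length) (x : ∀ i, TreeN Unit (c.blocksFun i)) :
    compositeEquiv R n hn (compositeMon (assRel R) (assRel R) c u x) = Pi.single c 1 := by
  rw [compositeEquiv, compositeMon, LinearEquiv.trans_apply, DFinsupp.mapRange.linearEquiv_apply,
    DirectSum.lof, DFinsupp.lsingle_apply, DFinsupp.mapRange_single,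
    ← DFinsupp.lsingle_apply (R := R)]
  refine (DirectSum.linearEquivFunOnFintype_lof R c _).trans ?_
  simp [assEquiv_mk_single]

variable {R}

theorem xi_compositeEquiv_symm_single (D : Rule R) {n : ℕ} (hn : 1 ≤ n)
    {c : Composition n} {t : TreeN Op n} (ht : IsNormal c.blocks t.1) :
    xi (assRel R) (assRel R) D n ((compositeEquiv R n hn).symm (Pi.single c 1)) =
      Submodule.Quotient.mk (Finsupp.single t 1) := by
  obtain ⟨u, x, h⟩ := ht.exists_xi_compositeMon_eq (assRel R) (assRel R) D
  rw [← h, ← compositeEquiv_compositeMon R hn c u x, LinearEquiv.symm_apply_apply]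

end Associative

section QuadraticRelations

variable {R : Type w} [CommRing R]

/-- The four quadratic relations of `quadRel`, as elements of the free operad. -/
def quadRelation (a b c d : R) : Fin 4 → Free R Op 3 :=
  ![leftMon R cir cir - rightMon R cir cir,
    leftMon R bul bul - rightMon R bul bul,
    leftMon R bul cir + a • leftMon R cir bul + b • rightMon R cir bul,
    rightMon R bul cir + c • leftMon R cir bul + d • rightMon R cir bul]

theorem substFree_quadRelation (a b c d : R) (i : Fin 4) (x y z : Total R Op) :
    substFree 3 (quadRelation a b c d i) ![x, y, z] = quadRel R a b c d i x y z := by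
  fin_cases i <;> simp [quadRelation, quadRel, substFree_leftMon, substFree_rightMon]

/-- The subspace spanned by the four quadratic relations. -/
def quadSpan (a b c d : R) : Submodule R (Free R Op 3) :=
  Submodule.span R (Set.range (quadRelation a b c d))

theorem quadRelation_mem_quadSpan (a b c d : R) (i : Fin 4) :
    quadRelation a b c d i ∈ quadSpan a b c d :=
  Submodule.subset_span ⟨i, rfl⟩

theorem freeMap_leftMon {α : Type u} {β : Type v} (f : α → β) (p q : α) :
    freeMap R f 3 (leftMon R p q) = leftMon R (f p) (f q) :=
  Finsupp.mapDomain_single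

theorem freeMap_rightMon {α : Type u} {β : Type v} (f : α → β) (p q : α) :
    freeMap R f 3 (rightMon R p q) = rightMon R (f p) (f q) :=
  Finsupp.mapDomain_single

theorem map_freeMap_assRel {β : Type v} (f : Unit → β) :
    (assRel R).map (freeMap R f 3) =
      Submodule.span R {leftMon R (f ()) (f ()) - rightMon R (f ()) (f ())} := by
  rw [assRel, Submodule.map_span, Set.image_singleton, map_sub, freeMap_leftMon, freeMap_rightMon]

theorem span_lhs_eq_top : Submodule.span R {lhs₁ R, lhs₂ R} = ⊤ := by
  refine Submodule.map_injective_of_injective (F12 R Unit Unit).injective_subtype ?_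
  rw [Submodule.map_span, Submodule.map_subtype_top]
  refine congrArg (Submodule.span R) (Set.ext fun x => ?_)
  simp only [Set.image_pair, Set.mem_insert_iff, Set.mem_singleton_iff, Set.exists_range_iff,
    Unique.exists_iff, Set.mem_ofPred_eq]
  rfl

theorem span_rhs_eq_top : Submodule.span R {rhs₁ R, rhs₂ R} = ⊤ := by
  refine Submodule.map_injective_of_injective (F21 R Unit Unit).injective_subtype ?_
  rw [Submodule.map_span, Submodule.map_subtype_top]
  refine congrArg (Submodule.span R) (Set.ext fun x => ?_)
  simp only [Set.image_pair, Set.mem_insert_iff, Set.mem_singleton_iff, Set.exists_range_iff,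
    Unique.exists_iff, Set.mem_ofPred_eq]
  rfl

theorem rule_ext {D D' : Rule R} (h₁ : D (lhs₁ R) = D' (lhs₁ R)) (h₂ : D (lhs₂ R) = D' (lhs₂ R)) :
    D = D' :=
  LinearMap.ext_on span_lhs_eq_top (by simp [Set.EqOn, h₁, h₂])

/-- The rule `D` has the coefficients `a, b, c, d`, with the signs that turn `u - D u` into the
relations `β₁` and `β₂`. -/
structure HasCoeffs (D : Rule R) (a b c d : R) : Prop where
  apply_lhs₁ : D (lhs₁ R) = -(a • rhs₁ R) - b • rhs₂ R
  apply_lhs₂ : D (lhs₂ R) = -(c • rhs₁ R) - d • rhs₂ R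

theorem exists_hasCoeffs (D : Rule R) : ∃ a b c d, HasCoeffs D a b c d := by
  have h (y : F21 R Unit Unit) : ∃ a b : R, y = -(a • rhs₁ R) - b • rhs₂ R := by
    have hy : y ∈ Submodule.span R {rhs₁ R, rhs₂ R} := by
      rw [span_rhs_eq_top]
      exact Submodule.mem_top
    obtain ⟨a, b, rfl⟩ := Submodule.mem_span_pair.1 hy
    exact ⟨-a, -b, by module⟩
  obtain ⟨a, b, hab⟩ := h (D (lhs₁ R))
  obtain ⟨c, d, hcd⟩ := h (D (lhs₂ R))
  exact ⟨a, b, c, d, hab, hcd⟩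

theorem ruleRel_eq_span_pair (D : Rule R) :
    ruleRel D = Submodule.span R {(lhs₁ R : Free R Op 3) - D (lhs₁ R),
      (lhs₂ R : Free R Op 3) - D (lhs₂ R)} := by
  let f := (F12 R Unit Unit).subtype - (F21 R Unit Unit).subtype ∘ₗ D
  change Submodule.span R (Set.range f) = Submodule.span R {f (lhs₁ R), f (lhs₂ R)}
  rw [← LinearMap.coe_range, Submodule.span_eq, ← Set.image_pair, ← Submodule.map_span,
    span_lhs_eq_top, LinearMap.range_eq_map]

theorem HasCoeffs.combinedRel_eq {D : Rule R} {a b c d : R} (h : HasCoeffs D a b c d) :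
    combinedRel (assRel R) (assRel R) D = quadSpan a b c d := by
  have h₁ : (lhs₁ R : Free R Op 3) - D (lhs₁ R) = quadRelation a b c d 2 := by
    rw [h.apply_lhs₁]
    change leftMon R bul cir - (-(a • leftMon R cir bul) - b • rightMon R cir bul) =
      leftMon R bul cir + a • leftMon R cir bul + b • rightMon R cir bul
    abel
  have h₂ : (lhs₂ R : Free R Op 3) - D (lhs₂ R) = quadRelation a b c d 3 := by
    rw [h.apply_lhs₂]
    change rightMon R bul cir - (-(c • leftMon R cir bul) - d • rightMon R cir bul) =
      rightMon R bul cir + c • leftMon R cir bul + d • rightMon R cir bul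
    abel
  rw [combinedRel, map_freeMap_assRel, map_freeMap_assRel, ruleRel_eq_span_pair, h₁, h₂, quadSpan,
    ← Submodule.span_union, ← Submodule.span_union]
  congr 1
  ext x
  simp only [Set.mem_union, Set.mem_singleton_iff, Set.mem_insert_iff, Set.mem_range,
    Fin.exists_fin_succ]
  simp only [quadRelation, Matrix.cons_val_zero, Matrix.cons_val_succ, IsEmpty.exists_iff,
    or_false, eq_comm (b := x)]
  tauto

end QuadraticRelations

section Algebras

variable {R : Type w} [CommRing R] {A : Type v} [AddCommGroup A] [Module R A]

/-- Two bilinear operations on `A` satisfy the four quadratic relations with parameters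
`a, b, c, d`, that is, they make `A` an algebra over the combined operad. -/
structure SatisfiesQuadRel (a b c d : R) (B : Op → A →ₗ[R] A →ₗ[R] A) : Prop where
  cir_assoc : ∀ x y z, B cir (B cir x y) z = B cir x (B cir y z)
  bul_assoc : ∀ x y z, B bul (B bul x y) z = B bul x (B bul y z)
  cir_bul : ∀ x y z,
    B bul (B cir x y) z = -(a • B cir (B bul x y) z) - b • B cir x (B bul y z)
  bul_cir : ∀ x y z,
    B bul x (B cir y z) = -(c • B cir (B bul x y) z) - d • B cir x (B bul y z)

variable {a b c d : R} {B : Op → A →ₗ[R] A →ₗ[R] A}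

theorem SatisfiesQuadRel.totalIdeal_le_ker (h : SatisfiesQuadRel a b c d B) (y : A) :
    totalIdeal (quadSpan a b c d) ≤ LinearMap.ker (evalTotal B fun _ => y) := by
  refine totalIdeal_le (isMulIdeal_ker_evalTotal_const B y) fun r hr x₁ x₂ x₃ => ?_
  induction hr using Submodule.span_induction with
  | zero => simp
  | add r r' _ _ hr hr' => simpa using add_mem hr hr'
  | smul t r _ hr => simpa using Submodule.smul_mem _ t hr
  | mem r hr =>
    obtain ⟨i, rfl⟩ := hr
    rw [substFree_quadRelation, LinearMap.mem_ker]
    fin_cases i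
    · simp [quadRel, evalTotal_const_mul, h.cir_assoc]
    · simp [quadRel, evalTotal_const_mul, h.bul_assoc]
    · simp [quadRel, evalTotal_const_mul, h.cir_bul, add_assoc]
    · simp [quadRel, evalTotal_const_mul, h.bul_cir, add_assoc]

theorem SatisfiesQuadRel.ambiguity_cir_cir_bul (h : SatisfiesQuadRel a b c d B) (w x y z : A) :
    (a ^ 2 - a * c) • B cir (B bul w x) (B cir y z) - (a * d) • B cir w (B cir (B bul x y) z) -
      (b + b ^ 2) • B cir w (B cir x (B bul y z)) = 0 := by
  have hw := congrArg (B bul · z) (h.cir_assoc w x y)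
  simp only [h.cir_bul _ y z, h.cir_bul w (B cir x y) z] at hw
  simp only [h.cir_bul, h.bul_cir, h.cir_assoc, map_sub, map_neg, map_smul, LinearMap.sub_apply,
    LinearMap.neg_apply, LinearMap.smul_apply] at hw
  linear_combination (norm := module) hw

theorem SatisfiesQuadRel.ambiguity_bul_cir_cir (h : SatisfiesQuadRel a b c d B) (w x y z : A) :
    (c ^ 2 + c) • B cir (B bul w x) (B cir y z) + (a * d) • B cir w (B cir (B bul x y) z) +
      (b * d - d ^ 2) • B cir w (B cir x (B bul y z)) = 0 := by
  have hw := congrArg (B bul w) (h.cir_assoc x y z)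
  simp only [h.bul_cir w _ z, h.bul_cir w x] at hw
  simp only [h.cir_bul, h.bul_cir, h.cir_assoc, map_sub, map_neg, map_smul, LinearMap.sub_apply,
    LinearMap.neg_apply, LinearMap.smul_apply] at hw
  linear_combination (norm := module) hw

theorem SatisfiesQuadRel.ambiguity_cir_bul_bul (h : SatisfiesQuadRel a b c d B) (w x y z : A) :
    (a ^ 2 + a * b) • B cir (B bul w (B bul x y)) z +
      (b ^ 2 + b) • B cir w (B bul x (B bul y z)) +
      (a * b + a) • B cir (B bul w x) (B bul y z) = 0 := by
  have hw := h.bul_assoc (B cir w x) y z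
  simp only [h.cir_bul, h.bul_assoc, map_sub, map_neg, map_smul, LinearMap.sub_apply,
    LinearMap.neg_apply, LinearMap.smul_apply] at hw
  linear_combination (norm := module) hw

theorem SatisfiesQuadRel.ambiguity_bul_bul_cir (h : SatisfiesQuadRel a b c d B) (w x y z : A) :
    (c ^ 2 + c) • B cir (B bul w (B bul x y)) z +
      (c * d + d ^ 2) • B cir w (B bul x (B bul y z)) +
      (d + c * d) • B cir (B bul w x) (B bul y z) = 0 := by
  have hw := h.bul_assoc w x (B cir y z)
  simp only [h.bul_cir, h.bul_assoc, map_sub, map_neg, map_smul] at hw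
  linear_combination (norm := module) -hw

end Algebras

section QuotientAlgebra

variable {R : Type w} [CommRing R] {α : Type u} {K : Submodule R (Total R α)}

/-- The operations induced on the quotient of the sum of all components by an ideal. -/
def IsMulIdeal.quotientMul (hK : IsMulIdeal K) (p : α) :
    (Total R α ⧸ K) →ₗ[R] (Total R α ⧸ K) →ₗ[R] (Total R α ⧸ K) :=
  K.liftQ
    { toFun := fun x => K.mapQ K (mul R p x) fun _ => hK.mul_right p x
      map_add' := fun _ _ => Submodule.linearMap_qext _ (LinearMap.ext fun _ => by simp)
      map_smul' := fun _ _ => Submodule.linearMap_qext _ (LinearMap.ext fun _ => by simp) }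
    fun _ hx => Submodule.linearMap_qext _ (LinearMap.ext fun y =>
      (Submodule.Quotient.mk_eq_zero K).2 (hK.mul_left p y hx))

theorem IsMulIdeal.quotientMul_mk (hK : IsMulIdeal K) (p : α) (x y : Total R α) :
    hK.quotientMul p (Submodule.Quotient.mk x) (Submodule.Quotient.mk y) =
      Submodule.Quotient.mk (mul R p x y) :=
  rfl

/-- The multiplications of the free algebra on one generator over the operad with parameters
`a, b, c, d`. -/
def quadMul (a b c d : R) : Op → (Total R Op ⧸ totalIdeal (quadSpan a b c d)) →ₗ[R]
    (Total R Op ⧸ totalIdeal (quadSpan a b c d)) →ₗ[R]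
      (Total R Op ⧸ totalIdeal (quadSpan a b c d)) :=
  (isMulIdeal_totalIdeal (quadSpan a b c d)).quotientMul

/-- The generator of the free algebra on one generator over the operad with parameters
`a, b, c, d`. -/
def quadGen (a b c d : R) : Total R Op ⧸ totalIdeal (quadSpan a b c d) :=
  Submodule.Quotient.mk (Finsupp.single .leaf 1)

theorem satisfiesQuadRel_quadMul (a b c d : R) : SatisfiesQuadRel a b c d (quadMul a b c d) := by
  have hrel (i : Fin 4) (x y z : Total R Op) :
      (Submodule.Quotient.mk (quadRel R a b c d i x y z) :
        Total R Op ⧸ totalIdeal (quadSpan a b c d)) = 0 := by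
    rw [Submodule.Quotient.mk_eq_zero, ← substFree_quadRelation]
    exact substFree_mem_totalIdeal (quadRelation_mem_quadSpan a b c d i) _
  constructor <;> rintro ⟨x⟩ ⟨y⟩ ⟨z⟩
  · exact sub_eq_zero.1 (hrel 0 x y z)
  · exact sub_eq_zero.1 (hrel 1 x y z)
  · rw [← neg_add', eq_neg_iff_add_eq_zero, ← add_assoc]
    exact hrel 2 x y z
  · rw [← neg_add', eq_neg_iff_add_eq_zero, ← add_assoc]
    exact hrel 3 x y z

end QuotientAlgebra

section Words

variable {α : Type u} {β : Type v}

/-- The word of the operations of a monomial, read between its leaves from left to right. -/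
def BTree.inorder : BTree α → List α
  | leaf => []
  | node a s t => s.inorder ++ a :: t.inorder

theorem BTree.inorder_map (f : α → β) (t : BTree α) : (t.map f).inorder = t.inorder.map f := by
  induction t with
  | leaf => rfl
  | node a s t hs ht => simp [BTree.map, inorder, hs, ht]

theorem BTree.length_inorder (t : BTree α) : t.inorder.length + 1 = t.leaves := by
  induction t with
  | leaf => rfl
  | node a s t hs ht =>
    simp only [inorder, List.length_append, List.length_cons, leaves]
    omega

/-- The letters of type `β` cut a word into subwords in the letters of type `α`; this is the list of
the lengths of these subwords, each increased by one. -/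
def wordBlocks : List (α ⊕ β) → List ℕ
  | [] => [1]
  | .inl _ :: w => (wordBlocks w).modifyHead (· + 1)
  | .inr _ :: w => 1 :: wordBlocks w

theorem wordBlocks_ne_nil (w : List (α ⊕ β)) : wordBlocks w ≠ [] := by
  induction w with
  | nil => simp [wordBlocks]
  | cons a w ih => cases a <;> simp [wordBlocks, ih]

theorem wordBlocks_map_inl (w : List α) :
    wordBlocks (w.map Sum.inl : List (α ⊕ β)) = [w.length + 1] := by
  induction w with
  | nil => rfl
  | cons a w ih => simp [wordBlocks, ih]

theorem wordBlocks_append_inr_cons (u w : List (α ⊕ β)) (b : β) :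
    wordBlocks (u ++ Sum.inr b :: w) = wordBlocks u ++ wordBlocks w := by
  induction u with
  | nil => rfl
  | cons a u ih =>
    cases a with
    | inl a =>
      obtain ⟨i, l, hl⟩ := List.exists_cons_of_ne_nil (wordBlocks_ne_nil u)
      simp [wordBlocks, ih, hl]
    | inr b => simp [wordBlocks, ih]

theorem IsNormal.wordBlocks_inorder {l : List ℕ} {t : BTree (α ⊕ β)} (ht : IsNormal l t) :
    wordBlocks t.inorder = l := by
  induction ht with
  | inner t => rw [BTree.inorder_map, wordBlocks_map_inl, BTree.length_inorder]
  | outer b _ _ ihs iht => rw [BTree.inorder, wordBlocks_append_inr_cons, ihs, iht]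

end Words

section WordAlgebra

variable {R : Type w} [CommRing R]

open Classical in
/-- The coefficient of `u • v` or `u ∘ v` in the product of the words `u` and `v`. The idempotents
`e` and `e'` are the scalars in the rules `(x ∘ y) • z = e x ∘ (y • z)` and
`x • (y ∘ z) = e' (x • y) ∘ z`; they are picked up when the left, respectively the right, factor of
`•` contains `∘`. -/
def weight (e e' : R) : Op → List Op → List Op → R
  | .inl _, u, v => (if cir ∈ u then e else 1) * (if cir ∈ v then e' else 1)
  | .inr _, _, _ => 1

/-- The operations on the span of all words in the letters `•`, `∘`: up to a scalar, the words are
concatenated, with the letter of the operation in between. -/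
def wordMul (e e' : R) (p : Op) : (List Op →₀ R) →ₗ[R] (List Op →₀ R) →ₗ[R] (List Op →₀ R) :=
  Finsupp.linearCombination R fun u : List Op =>
    Finsupp.linearCombination R fun v : List Op => Finsupp.single (u ++ p :: v) (weight e e' p u v)

variable (e e' : R)

theorem wordMul_single (p : Op) (u v : List Op) (c d : R) :
    wordMul e e' p (Finsupp.single u c) (Finsupp.single v d) =
      Finsupp.single (u ++ p :: v) (c * d * weight e e' p u v) := by
  simp [wordMul, mul_assoc, -Finsupp.single_mul]

theorem smul_wordMul_wordMul (p q : Op) {r r' : R}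
    (h : ∀ u v w, r * (weight e e' q u v * weight e e' p (u ++ q :: v) w) =
      r' * (weight e e' p v w * weight e e' q u (v ++ p :: w))) (x y z : List Op →₀ R) :
    r • wordMul e e' p (wordMul e e' q x y) z = r' • wordMul e e' q x (wordMul e e' p y z) := by
  induction x using Finsupp.induction_linear with
  | zero => simp
  | add x x' hx hx' => simp only [LinearMap.map_add₂, smul_add, hx, hx']
  | single u c =>
  induction y using Finsupp.induction_linear with
  | zero => simp
  | add y y' hy hy' => simp only [LinearMap.map_add₂, map_add (wordMul e e' q _), smul_add, hy, hy']
  | single v c' =>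
  induction z using Finsupp.induction_linear with
  | zero => simp
  | add z z' hz hz' => simp only [map_add, smul_add, hz, hz']
  | single w c'' =>
    simp only [wordMul_single, Finsupp.smul_single, List.append_assoc, List.cons_append,
      smul_eq_mul]
    congr 1
    linear_combination c * c' * c'' * h u v w

variable {e e'}

theorem satisfiesQuadRel_wordMul (he : IsIdempotentElem e) (he' : IsIdempotentElem e') :
    SatisfiesQuadRel 0 (-e) (-e') 0 (wordMul e e') where
  cir_assoc x y z := by
    simpa using smul_wordMul_wordMul e e' cir cir (r := 1) (r' := 1) (by simp [weight]) x y z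
  bul_assoc x y z := by
    simpa using smul_wordMul_wordMul e e' bul bul (r := 1) (r' := 1) (fun u v w => by
      simp only [weight, List.mem_append, List.mem_cons, reduceCtorEq, false_or]
      split_ifs <;> grind [he.eq, he'.eq]) x y z
  cir_bul x y z := by
    simpa using smul_wordMul_wordMul e e' bul cir (r := 1) (r' := e) (fun u v w => by
      simp only [weight, List.mem_append, List.mem_cons, true_or, or_true, if_true]
      split_ifs <;> grind [he.eq]) x y z
  bul_cir x y z := by
    simpa using (smul_wordMul_wordMul e e' cir bul (r := e') (r' := 1) (fun u v w => by
      simp only [weight, List.mem_append, List.mem_cons, true_or, or_true, if_true]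
      split_ifs <;> grind [he'.eq]) x y z).symm

theorem evalTree_wordMul_map_inl (t : BTree Unit) :
    evalTree (wordMul e e') (t.map Sum.inl) (fun _ => Finsupp.single [] 1) =
      Finsupp.single (t.map Sum.inl).inorder 1 := by
  induction t with
  | leaf => rfl
  | node a s t hs ht =>
    rw [BTree.map, evalTree, hs, ht, wordMul_single]
    simp [weight, BTree.inorder, BTree.inorder_map]

theorem IsNormal.evalTree_wordMul {l : List ℕ} {t : BTree Op} (ht : IsNormal l t) :
    evalTree (wordMul e e') t (fun _ => Finsupp.single [] 1) = Finsupp.single t.inorder 1 := by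
  induction ht with
  | inner t => exact evalTree_wordMul_map_inl t
  | outer b _ _ ihs iht =>
    rw [evalTree, ihs, iht, wordMul_single]
    simp [weight, BTree.inorder]

end WordAlgebra

section Sufficiency

variable {R : Type w} [CommRing R] {D : Rule R}

/-- The evaluation of the operations of the combined operad with all variables equal to `y`. -/
def HasCoeffs.evalOperad {A : Type v} [AddCommGroup A] [Module R A] {B : Op → A →ₗ[R] A →ₗ[R] A}
    {a b c d : R} (hD : HasCoeffs D a b c d) (hB : SatisfiesQuadRel a b c d B) (y : A) (n : ℕ) :
    Operad (combinedRel (assRel R) (assRel R) D) n →ₗ[R] A :=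
  (ideal (combinedRel (assRel R) (assRel R) D) n).liftQ
    (evalTotal B (fun _ => y) ∘ₗ incl R n) fun x hx => by
      rw [hD.combinedRel_eq, mem_ideal_iff] at hx
      exact hB.totalIdeal_le_ker y hx

theorem HasCoeffs.evalOperad_mk_single {A : Type v} [AddCommGroup A] [Module R A]
    {B : Op → A →ₗ[R] A →ₗ[R] A} {a b c d : R} (hD : HasCoeffs D a b c d)
    (hB : SatisfiesQuadRel a b c d B) (y : A) {n : ℕ} (t : TreeN Op n) :
    hD.evalOperad hB y n (Submodule.Quotient.mk (Finsupp.single t 1)) =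
      evalTree B t.1 fun _ => y := by
  change evalTotal B _ (incl R n (Finsupp.single t 1)) = _
  rw [incl_single, evalTotal_single, one_smul]

variable {e e' : R}

theorem HasCoeffs.xi_injective (hD : HasCoeffs D 0 (-e) (-e') 0) (he : IsIdempotentElem e)
    (he' : IsIdempotentElem e') {n : ℕ} (hn : 1 ≤ n) :
    Function.Injective (xi (assRel R) (assRel R) D n) := by
  let blocksOf : Operad (combinedRel (assRel R) (assRel R) D) n →ₗ[R] (List ℕ →₀ R) :=
    Finsupp.lmapDomain R R wordBlocks ∘ₗ
      hD.evalOperad (satisfiesQuadRel_wordMul he he') (Finsupp.single [] 1) n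
  have hblocks :
      blocksOf ∘ₗ xi (assRel R) (assRel R) D n ∘ₗ (compositeEquiv R n hn).symm.toLinearMap =
      Finsupp.lmapDomain R R Composition.blocks ∘ₗ
        (Finsupp.linearEquivFunOnFinite R R (Composition n)).symm.toLinearMap := by
    refine LinearMap.pi_ext' fun c => LinearMap.ext_ring ?_
    obtain ⟨t, ht⟩ := exists_isNormal_blocks () () hn c
    change blocksOf (xi _ _ D n ((compositeEquiv R n hn).symm (Pi.single c 1))) =
      Finsupp.mapDomain _ ((Finsupp.linearEquivFunOnFinite R R _).symm (Pi.single c 1))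
    rw [xi_compositeEquiv_symm_single D hn ht, Finsupp.linearEquivFunOnFinite_symm_single,
      Finsupp.mapDomain_single]
    change Finsupp.mapDomain wordBlocks (hD.evalOperad _ _ n _) = _
    rw [hD.evalOperad_mk_single, ht.evalTree_wordMul, Finsupp.mapDomain_single,
      ht.wordBlocks_inorder]
  have hinj : Function.Injective
      (blocksOf ∘ xi (assRel R) (assRel R) D n ∘ (compositeEquiv R n hn).symm) := by
    rw [← LinearEquiv.coe_coe, ← LinearMap.coe_comp, ← LinearMap.coe_comp, hblocks]
    exact (Finsupp.mapDomain_injective fun _ _ => Composition.ext).comp (LinearEquiv.injective _)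
  exact (Function.Injective.of_comp_iff' _ (compositeEquiv R n hn).symm.bijective).1
    hinj.of_comp

theorem HasCoeffs.isAssAssLaw (hD : HasCoeffs D 0 (-e) (-e') 0) (he : IsIdempotentElem e)
    (he' : IsIdempotentElem e') : IsAssAssLaw D := fun n hn =>
  ⟨hD.xi_injective he he' (one_le_two.trans hn), xi_surjective (assRel R) (assRel R) D n⟩

end Sufficiency

section Naturality

variable {A : Type v} {B : Type w} [CommRing A] [CommRing B] (f : A →+* B) {α : Type u}

/-- Change of scalars for linear combinations of monomials. -/
def scalarMap : Total A α →+ Total B α :=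
  Finsupp.mapRange.addMonoidHom f.toAddMonoidHom

theorem scalarMap_apply (x : Total A α) (t : BTree α) : scalarMap f x t = f (x t) := rfl

theorem scalarMap_single (t : BTree α) (c : A) :
    scalarMap f (Finsupp.single t c) = Finsupp.single t (f c) := by
  simp [scalarMap]

theorem scalarMap_smul (c : A) (x : Total A α) : scalarMap f (c • x) = f c • scalarMap f x := by
  ext t
  simp [scalarMap_apply]

theorem scalarMap_mul (a : α) (x y : Total A α) :
    scalarMap f (mul A a x y) = mul B a (scalarMap f x) (scalarMap f y) := by
  induction x using Finsupp.induction_linear with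
  | zero => simp
  | add x x' hx hx' => rw [LinearMap.map_add₂, map_add, map_add, LinearMap.map_add₂, hx, hx']
  | single s b =>
  induction y using Finsupp.induction_linear with
  | zero => simp
  | add y y' hy hy' => simp only [map_add, hy, hy']
  | single t c => simp only [mul_single_single, scalarMap_single, map_mul]

theorem scalarMap_quadRel (a b c d : A) (i : Fin 4) (x y z : Total A Op) :
    scalarMap f (quadRel A a b c d i x y z) =
      quadRel B (f a) (f b) (f c) (f d) i (scalarMap f x) (scalarMap f y) (scalarMap f z) := by
  fin_cases i <;> simp [quadRel, scalarMap_mul, scalarMap_smul]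

theorem scalarMap_cubicConsequence {ρ : Total A Op → Total A Op → Total A Op → Total A Op}
    {ρ' : Total B Op → Total B Op → Total B Op → Total B Op}
    (h : ∀ x y z, scalarMap f (ρ x y z) = ρ' (scalarMap f x) (scalarMap f y) (scalarMap f z))
    (j : Fin 10) : scalarMap f (cubicConsequence A ρ j) = cubicConsequence B ρ' j := by
  fin_cases j <;> simp [cubicConsequence, h, scalarMap_mul, scalarMap_single]

/-- The value of the matrix of cubic consequences at `(a, b, c, d)`. -/
def cubicMatrixAt (a b c d : A) : Matrix (Fin 4 × Fin 10) (Fin 5 × Op × Op × Op) A :=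
  fun i j => cubicConsequence A (quadRel A a b c d i.1) i.2
    (cubicMonomial j.2.1 j.2.2.1 j.2.2.2 j.1)

theorem cubicMatrix_map_eval (a b c d : A) :
    (cubicMatrix A).map (MvPolynomial.eval ![a, b, c, d]) = cubicMatrixAt a b c d := by
  ext i j
  change MvPolynomial.eval ![a, b, c, d] (cubicConsequence _ _ _ _) = _
  rw [← scalarMap_apply, scalarMap_cubicConsequence _ (scalarMap_quadRel _ _ _ _ _ i.1)]
  simp [cubicMatrixAt]

end Naturality

section CubicMonomials

theorem leaves_cubicMonomial (p q r : Op) (i : Fin 5) : (cubicMonomial p q r i).leaves = 4 := by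
  fin_cases i <;> rfl

theorem cubicMonomial_injective :
    Function.Injective fun j : Fin 5 × Op × Op × Op => cubicMonomial j.2.1 j.2.2.1 j.2.2.2 j.1 := by
  rintro ⟨i, p, q, r⟩ ⟨i', p', q', r'⟩ h
  fin_cases i <;> fin_cases i' <;> simp_all [cubicMonomial]

theorem exists_eq_cubicMonomial {t : BTree Op} (h : t.leaves = 4) :
    ∃ i p q r, t = cubicMonomial p q r i := by
  cases t with
  | leaf => simp [BTree.leaves] at h
  | node r s t =>
    have := s.leaves_pos
    have := t.leaves_pos
    simp only [BTree.leaves] at h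
    obtain hs | hs | hs : s.leaves = 1 ∨ s.leaves = 2 ∨ s.leaves = 3 := by omega
    · obtain rfl := eq_leaf_of_leaves_eq_one hs
      obtain ⟨p, q, ht | ht⟩ := eq_leftTree_or_eq_rightTree ⟨t, show t.leaves = 3 by omega⟩ <;>
        obtain rfl := congrArg Subtype.val ht
      · exact ⟨3, r, q, p, rfl⟩
      · exact ⟨4, r, p, q, rfl⟩
    · obtain ⟨p, rfl⟩ := exists_eq_node_leaf_leaf hs
      obtain ⟨q, rfl⟩ := exists_eq_node_leaf_leaf (show t.leaves = 2 by omega)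
      exact ⟨2, p, r, q, rfl⟩
    · obtain rfl := eq_leaf_of_leaves_eq_one (show t.leaves = 1 by omega)
      obtain ⟨p, q, hs | hs⟩ := eq_leftTree_or_eq_rightTree ⟨s, hs⟩ <;>
        obtain rfl := congrArg Subtype.val hs
      · exact ⟨0, q, p, r, rfl⟩
      · exact ⟨1, p, q, r, rfl⟩

/-- The enumeration of the monomials of arity `4` that indexes the columns of the matrix of cubic
consequences. -/
def cubicMonomialEquiv : Fin 5 × Op × Op × Op ≃ TreeN Op 4 :=
  Equiv.ofBijective
    (fun j => ⟨cubicMonomial j.2.1 j.2.2.1 j.2.2.2 j.1, leaves_cubicMonomial _ _ _ _⟩)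
    ⟨fun _ _ h => cubicMonomial_injective (congrArg Subtype.val h), fun ⟨_, ht⟩ =>
      let ⟨i, p, q, r, h⟩ := exists_eq_cubicMonomial ht
      ⟨(i, p, q, r), Subtype.ext h.symm⟩⟩

/-- The coordinates of the operations of arity `4` with respect to the monomials. -/
def cubicCoords (R : Type w) [CommRing R] : Free R Op 4 ≃ₗ[R] (Fin 5 × Op × Op × Op → R) :=
  (Finsupp.domLCongr cubicMonomialEquiv.symm).trans (Finsupp.linearEquivFunOnFinite R R _)

end CubicMonomials

section CubicConsequences

variable {R : Type w} [CommRing R]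

/-- The operation that the `j`-th cubic consequence of `ρ` defines in arity `4`, as a linear
function of `ρ`. -/
def cubicMap (j : Fin 10) : Free R Op 3 →ₗ[R] Free R Op 4 :=
  proj R 4 ∘ₗ
    { toFun := fun r => cubicConsequence R (fun x y z => substFree 3 r ![x, y, z]) j
      map_add' := fun r r' => by fin_cases j <;> simp [cubicConsequence]
      map_smul' := fun c r => by fin_cases j <;> simp [cubicConsequence] }

theorem cubicMap_apply (j : Fin 10) (r : Free R Op 3) :
    cubicMap j r = proj R 4 (cubicConsequence R (fun x y z => substFree 3 r ![x, y, z]) j) :=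
  rfl

variable {S : Submodule R (Free R Op 3)}

theorem cubicConsequence_mem_totalIdeal {r : Free R Op 3} (hr : r ∈ S) (j : Fin 10) :
    cubicConsequence R (fun x y z => substFree 3 r ![x, y, z]) j ∈ totalIdeal S := by
  have hsubst (x y z : Total R Op) := substFree_mem_totalIdeal hr ![x, y, z]
  have hK := isMulIdeal_totalIdeal S
  fin_cases j
  iterate 6 exact hsubst _ _ _
  iterate 2 exact hK.mul_left _ _ (hsubst _ _ _)
  iterate 2 exact hK.mul_right _ _ (hsubst _ _ _)

theorem IsConsequence.three_le {α : Type u} {S : Submodule R (Free R α 3)} {n : ℕ} {x : Total R α}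
    (hx : IsConsequence S n x) : 3 ≤ n := by
  induction hx with
  | rel _ s t u =>
    have := s.leaves_pos
    have := t.leaves_pos
    have := u.leaves_pos
    omega
  | mul_left _ _ _ ih => exact ih.trans (Nat.le_add_right _ _)
  | mul_right _ _ _ ih => exact ih.trans (Nat.le_add_left _ _)

theorem IsConsequence.exists_eq_substFree_leaf {α : Type u} {S : Submodule R (Free R α 3)} {n : ℕ}
    {x : Total R α} (hx : IsConsequence S n x) (hn : n = 3) :
    ∃ r ∈ S, x = substFree 3 r
      ![Finsupp.single .leaf 1, Finsupp.single .leaf 1, Finsupp.single .leaf 1] := by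
  cases hx with
  | @rel r hr s t u =>
    have := s.leaves_pos
    have := t.leaves_pos
    have := u.leaves_pos
    obtain rfl := eq_leaf_of_leaves_eq_one (show s.leaves = 1 by omega)
    obtain rfl := eq_leaf_of_leaves_eq_one (show t.leaves = 1 by omega)
    obtain rfl := eq_leaf_of_leaves_eq_one (show u.leaves = 1 by omega)
    exact ⟨r, hr, rfl⟩
  | mul_left _ hx t =>
    have := hx.three_le
    have := t.leaves_pos
    omega
  | mul_right _ s hx =>
    have := hx.three_le
    have := s.leaves_pos
    omega

theorem exists_substFree_eq_cubicConsequence (r : Free R Op 3) {s t u : BTree Op}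
    (h : s.leaves + t.leaves + u.leaves = 4) :
    ∃ j, substFree 3 r ![Finsupp.single s 1, Finsupp.single t 1, Finsupp.single u 1] =
      cubicConsequence R (fun x y z => substFree 3 r ![x, y, z]) j := by
  have := s.leaves_pos
  have := t.leaves_pos
  have := u.leaves_pos
  obtain hs | hs | hs : s.leaves = 2 ∨ t.leaves = 2 ∨ u.leaves = 2 := by omega
  · obtain ⟨⟨⟩ | ⟨⟩, rfl⟩ := exists_eq_node_leaf_leaf hs <;>
      obtain rfl := eq_leaf_of_leaves_eq_one (show t.leaves = 1 by omega) <;>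
      obtain rfl := eq_leaf_of_leaves_eq_one (show u.leaves = 1 by omega)
    · exact ⟨1, by simp [cubicConsequence, mul_single_single]⟩
    · exact ⟨0, by simp [cubicConsequence, mul_single_single]⟩
  · obtain ⟨⟨⟩ | ⟨⟩, rfl⟩ := exists_eq_node_leaf_leaf hs <;>
      obtain rfl := eq_leaf_of_leaves_eq_one (show s.leaves = 1 by omega) <;>
      obtain rfl := eq_leaf_of_leaves_eq_one (show u.leaves = 1 by omega)
    · exact ⟨3, by simp [cubicConsequence, mul_single_single]⟩
    · exact ⟨2, by simp [cubicConsequence, mul_single_single]⟩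
  · obtain ⟨⟨⟩ | ⟨⟩, rfl⟩ := exists_eq_node_leaf_leaf hs <;>
      obtain rfl := eq_leaf_of_leaves_eq_one (show s.leaves = 1 by omega) <;>
      obtain rfl := eq_leaf_of_leaves_eq_one (show t.leaves = 1 by omega)
    · exact ⟨5, by simp [cubicConsequence, mul_single_single]⟩
    · exact ⟨4, by simp [cubicConsequence, mul_single_single]⟩

theorem IsConsequence.exists_eq_cubicConsequence {x : Total R Op} (hx : IsConsequence S 4 x) :
    ∃ r ∈ S, ∃ j, x = cubicConsequence R (fun x y z => substFree 3 r ![x, y, z]) j := by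
  generalize hn : 4 = n at hx
  cases hx with
  | @rel r hr s t u => exact ⟨r, hr, exists_substFree_eq_cubicConsequence r hn.symm⟩
  | @mul_left n x p hx t =>
    have := hx.three_le
    have := t.leaves_pos
    obtain rfl : n = 3 := by omega
    obtain rfl := eq_leaf_of_leaves_eq_one (show t.leaves = 1 by omega)
    obtain ⟨r, hr, rfl⟩ := hx.exists_eq_substFree_leaf rfl
    obtain ⟨⟩ | ⟨⟩ := p
    · exact ⟨r, hr, 7, rfl⟩
    · exact ⟨r, hr, 6, rfl⟩
  | @mul_right n x p s hx =>
    have := hx.three_le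
    have := s.leaves_pos
    obtain rfl : n = 3 := by omega
    obtain rfl := eq_leaf_of_leaves_eq_one (show s.leaves = 1 by omega)
    obtain ⟨r, hr, rfl⟩ := hx.exists_eq_substFree_leaf rfl
    obtain ⟨⟩ | ⟨⟩ := p
    · exact ⟨r, hr, 9, rfl⟩
    · exact ⟨r, hr, 8, rfl⟩

theorem ideal_four_eq_iSup (S : Submodule R (Free R Op 3)) :
    ideal S 4 = ⨆ j, S.map (cubicMap j) := by
  refine le_antisymm (fun x hx => ?_) (iSup_le fun j => Submodule.map_le_iff_le_comap.2 fun r hr =>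
    proj_mem_ideal (cubicConsequence_mem_totalIdeal hr j) 4)
  suffices h : totalIdeal S ≤ (⨆ j, S.map (cubicMap j)).comap (proj R 4) by
    simpa only [Submodule.mem_comap, proj_incl] using h (mem_ideal_iff.1 hx)
  refine Submodule.span_le.2 ?_
  rintro x ⟨n, hx⟩
  obtain rfl | hn := eq_or_ne n 4
  · obtain ⟨r, hr, j, rfl⟩ := hx.exists_eq_cubicConsequence
    exact Submodule.mem_iSup_of_mem j ⟨r, hr, cubicMap_apply j r⟩
  · simp [proj_of_ne hn hx.mem_homog]

theorem cubicMap_quadRelation (a b c d : R) (i : Fin 4) (j : Fin 10) :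
    cubicMap j (quadRelation a b c d i) =
      proj R 4 (cubicConsequence R (quadRel R a b c d i) j) := by
  simp only [cubicMap_apply, substFree_quadRelation]

theorem ideal_quadSpan_four (a b c d : R) :
    ideal (quadSpan a b c d) 4 = Submodule.span R (Set.range fun i : Fin 4 × Fin 10 =>
      proj R 4 (cubicConsequence R (quadRel R a b c d i.1) i.2)) := by
  simp only [ideal_four_eq_iSup, quadSpan, Submodule.map_span, ← Submodule.span_iUnion,
    ← Set.range_comp, Function.comp_def, cubicMap_quadRelation]
  congr 1
  ext x
  simp [Set.mem_iUnion, exists_comm (α := Fin 10)]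

theorem map_cubicCoords_ideal_quadSpan (a b c d : R) :
    (ideal (quadSpan a b c d) 4).map (cubicCoords R).toLinearMap =
      Submodule.span R (Set.range (cubicMatrixAt a b c d).row) := by
  rw [ideal_quadSpan_four, Submodule.map_span, ← Set.range_comp]
  congr 2

end CubicConsequences

section Rank

variable {k : Type w} [Field k]

theorem rank_cubicMatrixAt (a b c d : k) :
    (cubicMatrixAt a b c d).rank = Module.finrank k (ideal (quadSpan a b c d) 4) := by
  rw [Matrix.rank_eq_finrank_span_row, ← map_cubicCoords_ideal_quadSpan]
  exact LinearEquiv.finrank_map_eq _ _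

theorem finrank_operad_add_rank_cubicMatrixAt (a b c d : k) :
    Module.finrank k (Operad (quadSpan a b c d) 4) + (cubicMatrixAt a b c d).rank = 40 := by
  rw [rank_cubicMatrixAt]
  have := (cubicCoords k).symm.finiteDimensional
  rw [Submodule.finrank_quotient_add_finrank, (cubicCoords k).finrank_eq, Module.finrank_pi]
  rfl

theorem HasCoeffs.bijective_xi_four_iff {D : Rule k} {a b c d : k} (h : HasCoeffs D a b c d) :
    Function.Bijective (xi (assRel k) (assRel k) D 4) ↔ (cubicMatrixAt a b c d).rank = 32 := by
  have hrank := finrank_operad_add_rank_cubicMatrixAt a b c d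
  rw [← h.combinedRel_eq] at hrank
  have hcompositions : Module.finrank k (Composition 4 → k) = 8 := by
    rw [Module.finrank_pi, composition_card]
    rfl
  let e := compositeEquiv k 4 (by norm_num)
  let f : (Composition 4 → k) →ₗ[k] Operad (combinedRel (assRel k) (assRel k) D) 4 :=
    xi (assRel k) (assRel k) D 4 ∘ₗ e.symm.toLinearMap
  have hsurj : Function.Surjective f :=
    (xi_surjective (assRel k) (assRel k) D 4).comp e.symm.surjective
  have := Module.Finite.of_surjective f hsurj
  rw [← Function.Bijective.of_comp_iff _ e.symm.bijective]
  refine ⟨fun hbij => ?_, fun hr => ⟨?_, hsurj⟩⟩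
  · have := (LinearEquiv.ofBijective f hbij).finrank_eq
    omega
  · refine (LinearMap.injective_iff_surjective_of_finrank_eq_finrank (f := f) ?_).2 hsurj
    omega

end Rank

section Necessity

variable {R : Type w} [CommRing R]

theorem linearIndependent_mk_single {D : Rule R} {n : ℕ} (hn : 1 ≤ n)
    (hinj : Function.Injective (xi (assRel R) (assRel R) D n)) {ι : Type*} {l : ι → List ℕ}
    {t : ι → BTree Op} (hl : Function.Injective l) (ht : ∀ i, IsNormal (l i) (t i))
    (hleaves : ∀ i, (t i).leaves = n) :
    LinearIndependent R fun i => (Submodule.Quotient.mk (Finsupp.single (t i) 1) :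
      Total R Op ⧸ totalIdeal (combinedRel (assRel R) (assRel R) D)) := by
  let S := combinedRel (assRel R) (assRel R) D
  let c (i : ι) : Composition n :=
    ⟨l i, fun h => (ht i).pos _ h, (ht i).leaves_eq.symm.trans (hleaves i)⟩
  have hc : Function.Injective c := fun i j h => hl (congrArg Composition.blocks h)
  let toQuotient : Operad S n →ₗ[R] Total R Op ⧸ totalIdeal S :=
    (ideal S n).liftQ ((totalIdeal S).mkQ ∘ₗ incl R n) fun x hx => by
      simpa using mem_ideal_iff.1 hx
  have hker : LinearMap.ker toQuotient = ⊥ :=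
    Submodule.ker_liftQ_eq_bot _ _ _ fun x hx => mem_ideal_iff.2 (by simpa using hx)
  let φ : (Composition n → R) →ₗ[R] Total R Op ⧸ totalIdeal S :=
    toQuotient ∘ₗ xi (assRel R) (assRel R) D n ∘ₗ (compositeEquiv R n hn).symm.toLinearMap
  have hφ : Function.Injective φ := (LinearMap.ker_eq_bot.1 hker).comp
    (hinj.comp (compositeEquiv R n hn).symm.injective)
  have hli := ((Pi.linearIndependent_single_one (Composition n) R).comp c hc).map_injOn φ hφ.injOn
  convert hli using 2 with i
  change _ = toQuotient (xi _ _ D n ((compositeEquiv R n hn).symm (Pi.single (c i) 1)))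
  rw [xi_compositeEquiv_symm_single D hn (t := ⟨t i, hleaves i⟩) (ht i)]
  change _ = Submodule.Quotient.mk (incl R n (Finsupp.single _ 1))
  rw [incl_single]

variable {D : Rule R} {a b c d : R}

theorem HasCoeffs.linearIndependent_three_blocks (h : HasCoeffs D a b c d)
    (hinj : Function.Injective (xi (assRel R) (assRel R) D 4)) :
    let e := quadGen a b c d
    let B := quadMul a b c d
    LinearIndependent R ![B cir (B bul e e) (B cir e e), B cir e (B cir (B bul e e) e),
      B cir e (B cir e (B bul e e))] := by
  let x : BTree Op := .leaf
  have hli := linearIndependent_mk_single (by norm_num) hinj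
    (l := ![[2, 1, 1], [1, 2, 1], [1, 1, 2]])
    (t := ![.node cir (.node bul x x) (.node cir x x), .node cir x (.node cir (.node bul x x) x),
      .node cir x (.node cir x (.node bul x x))]) (by decide) (fun i => by
        fin_cases i
        · exact .outer () (.inner (.node () .leaf .leaf)) (.outer () (.inner .leaf) (.inner .leaf))
        · exact .outer () (.inner .leaf) (.outer () (.inner (.node () .leaf .leaf)) (.inner .leaf))
        · exact .outer () (.inner .leaf) (.outer () (.inner .leaf) (.inner (.node () .leaf .leaf))))
    (fun i => by fin_cases i <;> rfl)
  rw [h.combinedRel_eq] at hli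
  convert hli using 1
  ext i
  fin_cases i <;> simp [quadMul, quadGen, IsMulIdeal.quotientMul_mk, mul_single_single, x]

theorem HasCoeffs.linearIndependent_two_blocks (h : HasCoeffs D a b c d)
    (hinj : Function.Injective (xi (assRel R) (assRel R) D 4)) :
    let e := quadGen a b c d
    let B := quadMul a b c d
    LinearIndependent R ![B cir (B bul e (B bul e e)) e, B cir e (B bul e (B bul e e)),
      B cir (B bul e e) (B bul e e)] := by
  let x : BTree Op := .leaf
  have hli := linearIndependent_mk_single (by norm_num) hinj
    (l := ![[3, 1], [1, 3], [2, 2]])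
    (t := ![.node cir (.node bul x (.node bul x x)) x, .node cir x (.node bul x (.node bul x x)),
      .node cir (.node bul x x) (.node bul x x)]) (by decide) (fun i => by
        fin_cases i
        · exact .outer () (.inner (.node () .leaf (.node () .leaf .leaf))) (.inner .leaf)
        · exact .outer () (.inner .leaf) (.inner (.node () .leaf (.node () .leaf .leaf)))
        · exact .outer () (.inner (.node () .leaf .leaf)) (.inner (.node () .leaf .leaf)))
    (fun i => by fin_cases i <;> rfl)
  rw [h.combinedRel_eq] at hli
  convert hli using 1
  ext i
  fin_cases i <;> simp [quadMul, quadGen, IsMulIdeal.quotientMul_mk, mul_single_single, x]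

theorem eq_zero_of_linearIndependent_triple {M : Type*} [AddCommGroup M] [Module R M]
    {x y z : M} (hli : LinearIndependent R ![x, y, z]) {r s t : R}
    (h : r • x + s • y + t • z = 0) : r = 0 ∧ s = 0 ∧ t = 0 := by
  have hzero := Fintype.linearIndependent_iff.1 hli ![r, s, t] (by
    simpa [Fin.sum_univ_three] using h)
  exact ⟨hzero 0, hzero 1, hzero 2⟩

theorem HasCoeffs.coeffs_of_injective [IsDomain R] [NeZero (2 : R)] (h : HasCoeffs D a b c d)
    (hinj : Function.Injective (xi (assRel R) (assRel R) D 4)) :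
    a = 0 ∧ d = 0 ∧ (b = 0 ∨ b = -1) ∧ (c = 0 ∨ c = -1) := by
  have hB := satisfiesQuadRel_quadMul a b c d
  let e := quadGen a b c d
  have hthree := h.linearIndependent_three_blocks hinj
  have htwo := h.linearIndependent_two_blocks hinj
  obtain ⟨hac, -, hb⟩ : a ^ 2 - a * c = 0 ∧ -(a * d) = 0 ∧ -(b + b ^ 2) = 0 :=
    eq_zero_of_linearIndependent_triple hthree (by
      simpa only [neg_smul, ← sub_eq_add_neg] using hB.ambiguity_cir_cir_bul e e e e)
  obtain ⟨hc, -, hbd⟩ := eq_zero_of_linearIndependent_triple hthree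
    (hB.ambiguity_bul_cir_cir e e e e)
  obtain ⟨haab, -, hab⟩ := eq_zero_of_linearIndependent_triple htwo
    (hB.ambiguity_cir_bul_bul e e e e)
  obtain ⟨-, hcdd, hcd⟩ := eq_zero_of_linearIndependent_triple htwo
    (hB.ambiguity_bul_bul_cir e e e e)
  have haa : a ^ 2 = a := by linear_combination haab - hab
  have hca : a * c = a := by linear_combination haa - hac
  have hdd : d ^ 2 = d := by linear_combination hcdd - hcd
  have hdb : b * d = d := by linear_combination hbd + hdd
  have ha : 2 * a = 0 := by linear_combination a * hc - (c + 2) * hca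
  have hd : 2 * d = 0 := by linear_combination -d * hb - (b + 2) * hdb
  refine ⟨by simpa [two_ne_zero] using ha, by simpa [two_ne_zero] using hd, ?_, ?_⟩
  · rw [← add_eq_zero_iff_eq_neg, ← mul_eq_zero]
    linear_combination -hb
  · rw [← add_eq_zero_iff_eq_neg, ← mul_eq_zero]
    linear_combination hc

end Necessity

section Classification

variable {R : Type w} [CommRing R]

theorem HasCoeffs.isAssAssLaw_of_eq {D : Rule R} {b c : R} (h : HasCoeffs D 0 b c 0)
    (hb : b = 0 ∨ b = -1) (hc : c = 0 ∨ c = -1) : IsAssAssLaw D := by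
  have hidem {x : R} (hx : x = 0 ∨ x = -1) : IsIdempotentElem (-x) := by
    rcases hx with rfl | rfl <;> simp [IsIdempotentElem]
  exact HasCoeffs.isAssAssLaw (e := -b) (e' := -c) (by simpa only [neg_neg] using h)
    (hidem hb) (hidem hc)

theorem HasCoeffs.isAssAssLaw_iff_injective_xi_four [IsDomain R] [NeZero (2 : R)] {D : Rule R}
    {a b c d : R} (h : HasCoeffs D a b c d) :
    IsAssAssLaw D ↔ Function.Injective (xi (assRel R) (assRel R) D 4) := by
  refine ⟨fun hD => (hD 4 (by norm_num)).1, fun hinj => ?_⟩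
  obtain ⟨rfl, rfl, hb, hc⟩ := h.coeffs_of_injective hinj
  exact h.isAssAssLaw_of_eq hb hc

theorem hasCoeffs_zero_iff {D : Rule R} {b c : R} :
    HasCoeffs D 0 b c 0 ↔ D (lhs₁ R) = -b • rhs₂ R ∧ D (lhs₂ R) = -c • rhs₁ R := by
  have hleft (t : R) (x y : F21 R Unit Unit) : -((0 : R) • x) - t • y = -t • y := by module
  have hright (t : R) (x y : F21 R Unit Unit) : -(t • x) - (0 : R) • y = -t • x := by module
  refine ⟨fun h => ?_, fun h => ⟨?_, ?_⟩⟩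
  · rw [h.apply_lhs₁, h.apply_lhs₂, hleft, hright]
    exact ⟨rfl, rfl⟩
  · rw [h.1, hleft]
  · rw [h.2, hright]

theorem exists_eq_neg_smul_iff {M : Type*} [AddCommGroup M] [Module R M] {x y : M} :
    (∃ b : R, (b = 0 ∨ b = -1) ∧ x = -b • y) ↔ x = 0 ∨ x = y := by
  simp [or_and_right, exists_or]

theorem isAssAssLaw_iff [IsDomain R] [NeZero (2 : R)] (D : Rule R) :
    IsAssAssLaw D ↔ (D (lhs₁ R) = 0 ∨ D (lhs₁ R) = rhs₂ R) ∧
      (D (lhs₂ R) = 0 ∨ D (lhs₂ R) = rhs₁ R) := by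
  have hiff (x y : F21 R Unit Unit) := exists_eq_neg_smul_iff (R := R) (x := x) (y := y)
  rw [← hiff, ← hiff]
  constructor
  · intro hD
    obtain ⟨a, b, c, d, h⟩ := exists_hasCoeffs D
    obtain ⟨rfl, rfl, hb, hc⟩ :=
      h.coeffs_of_injective (h.isAssAssLaw_iff_injective_xi_four.1 hD)
    obtain ⟨h₁, h₂⟩ := hasCoeffs_zero_iff.1 h
    exact ⟨⟨b, hb, h₁⟩, ⟨c, hc, h₂⟩⟩
  · rintro ⟨⟨b, hb, h₁⟩, ⟨c, hc, h₂⟩⟩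
    exact (hasCoeffs_zero_iff.2 ⟨h₁, h₂⟩).isAssAssLaw_of_eq hb hc

/-- The rule `(x ∘ y) • z = r`, `x • (y ∘ z) = r'`. -/
def ruleOf (r r' : F21 R Unit Unit) : Rule R :=
  (LinearMap.toSpanSingleton R _ r ∘ₗ Finsupp.lapply (leftTree bul cir) +
    LinearMap.toSpanSingleton R _ r' ∘ₗ Finsupp.lapply (rightTree bul cir)) ∘ₗ
      (F12 R Unit Unit).subtype

theorem leftTree_ne_rightTree {α : Type u} (p q p' q' : α) : leftTree p q ≠ rightTree p' q' := by
  simp [leftTree, rightTree, Subtype.ext_iff]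

theorem ruleOf_lhs₁ (r r' : F21 R Unit Unit) : ruleOf r r' (lhs₁ R) = r := by
  simp [ruleOf, lhs₁, leftMon, (leftTree_ne_rightTree _ _ _ _).symm]

theorem ruleOf_lhs₂ (r r' : F21 R Unit Unit) : ruleOf r r' (lhs₂ R) = r' := by
  simp [ruleOf, lhs₂, rightMon, leftTree_ne_rightTree]

/-- A rule is determined by its two right hand sides, which are arbitrary. -/
def ruleEquiv (R : Type w) [CommRing R] : Rule R ≃ F21 R Unit Unit × F21 R Unit Unit where
  toFun D := (D (lhs₁ R), D (lhs₂ R))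
  invFun r := ruleOf r.1 r.2
  left_inv _ := rule_ext (ruleOf_lhs₁ _ _) (ruleOf_lhs₂ _ _)
  right_inv _ := Prod.ext (ruleOf_lhs₁ _ _) (ruleOf_lhs₂ _ _)

theorem rhs₁_ne_zero [Nontrivial R] : rhs₁ R ≠ 0 := by
  simp [rhs₁, leftMon, Subtype.ext_iff]

theorem rhs₂_ne_zero [Nontrivial R] : rhs₂ R ≠ 0 := by
  simp [rhs₂, rightMon, Subtype.ext_iff]

theorem ncard_isAssAssLaw [IsDomain R] [NeZero (2 : R)] :
    {D : Rule R | IsAssAssLaw D}.ncard = 4 := by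
  have himage : ruleEquiv R '' {D | IsAssAssLaw D} = {0, rhs₂ R} ×ˢ {0, rhs₁ R} := by
    ext ⟨r, r'⟩
    rw [Equiv.image_eq_preimage_symm]
    simp [isAssAssLaw_iff, ruleEquiv, ruleOf_lhs₁, ruleOf_lhs₂]
  rw [← Set.ncard_image_of_injective _ (ruleEquiv R).injective, himage, Set.ncard_prod,
    Set.ncard_pair rhs₂_ne_zero.symm, Set.ncard_pair rhs₁_ne_zero.symm]

end Classification

theorem HasCoeffs.isAssAssLaw_iff_rank {k : Type w} [Field k] [NeZero (2 : k)] {D : Rule k}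
    {a b c d : k} (h : HasCoeffs D a b c d) :
    IsAssAssLaw D ↔ ((cubicMatrix k).map (MvPolynomial.eval ![a, b, c, d])).rank = 32 := by
  rw [cubicMatrix_map_eval, ← h.bijective_xi_four_iff, h.isAssAssLaw_iff_injective_xi_four,
    Function.Bijective, and_iff_left (xi_surjective _ _ D 4)]

end NSOp

end

theorem mainTheorem3_general (k : Type*) [Field k] [NeZero (2 : k)] :
    (∀ D : NSOp.Rule k, NSOp.IsAssAssLaw D ↔
      (D (NSOp.lhs₁ k) = 0 ∧ D (NSOp.lhs₂ k) = 0) ∨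
      (D (NSOp.lhs₁ k) = 0 ∧ D (NSOp.lhs₂ k) = NSOp.rhs₁ k) ∨
      (D (NSOp.lhs₁ k) = NSOp.rhs₂ k ∧ D (NSOp.lhs₂ k) = 0) ∨
      (D (NSOp.lhs₁ k) = NSOp.rhs₂ k ∧ D (NSOp.lhs₂ k) = NSOp.rhs₁ k)) ∧
    {D : NSOp.Rule k | NSOp.IsAssAssLaw D}.ncard = 4 ∧
    (∀ (a b c d : k) (D : NSOp.Rule k),
      D (NSOp.lhs₁ k) = -(a • NSOp.rhs₁ k) - b • NSOp.rhs₂ k →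
      D (NSOp.lhs₂ k) = -(c • NSOp.rhs₁ k) - d • NSOp.rhs₂ k →
      (NSOp.IsAssAssLaw D ↔
        ((NSOp.cubicMatrix k).map (MvPolynomial.eval ![a, b, c, d])).rank = 32)) := by
  refine ⟨fun D => ?_, NSOp.ncard_isAssAssLaw, fun a b c d D h₁ h₂ =>
    NSOp.HasCoeffs.isAssAssLaw_iff_rank ⟨h₁, h₂⟩⟩
  rw [NSOp.isAssAssLaw_iff]
  tauto

theorem mainTheorem3 (k : Type*) [Field k] [CharZero k] :
    (∀ D : NSOp.Rule k, NSOp.IsAssAssLaw D ↔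
      (D (NSOp.lhs₁ k) = 0 ∧ D (NSOp.lhs₂ k) = 0) ∨
      (D (NSOp.lhs₁ k) = 0 ∧ D (NSOp.lhs₂ k) = NSOp.rhs₁ k) ∨
      (D (NSOp.lhs₁ k) = NSOp.rhs₂ k ∧ D (NSOp.lhs₂ k) = 0) ∨
      (D (NSOp.lhs₁ k) = NSOp.rhs₂ k ∧ D (NSOp.lhs₂ k) = NSOp.rhs₁ k)) ∧
    {D : NSOp.Rule k | NSOp.IsAssAssLaw D}.ncard = 4 ∧
    (∀ (a b c d : k) (D : NSOp.Rule k),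
      D (NSOp.lhs₁ k) = -(a • NSOp.rhs₁ k) - b • NSOp.rhs₂ k →
      D (NSOp.lhs₂ k) = -(c • NSOp.rhs₁ k) - d • NSOp.rhs₂ k →
      (NSOp.IsAssAssLaw D ↔
        ((NSOp.cubicMatrix k).map (MvPolynomial.eval ![a, b, c, d])).rank = 32)) :=
  mainTheorem3_general k
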